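/- A \emph{standard word} is a word $w$ in which each of the numbers $1,\dots,n$ ($n\ge 0$ its length) occurs exactly once. Its \emph{cocharge labeling} gives the number $1$ the label $0$, and gives $i+1$ the label of $i$ if $i+1$ is to the right of $i$ in $w$, and the label of $i$ plus one if $i+1$ is to the left of $i$. If $ya$ is a standard word with last number $a\neq 1$ and $a$ has positive label in $ya$, then $ay$ is a \emph{non-zero corotation} of $ya$, and $ya$ is a \emph{non-zero rotation} of $ay$. A \emph{catabolism transformation} of $w$ swaps two adjacent numbers of $w$ whose labels differ by more than one. A \emph{Knuth transformation} is one of $\cdots bac\cdots\leftrightarrow\cdots bca\cdots$, $\cdots acb\cdots\leftrightarrow\cdots cab\cdots$ with $a<b<c$. Tableaux are drawn in English notation; $P(w)$ is the Schensted row insertion tableau of a word $w$, and the row reading word $\mathrm{rowword}(T)$ reads the rows of $T$ from bottom to top, each from left to right. For a partition $\lambda=(\lambda_1,\widehat\lambda)$ of $|T|$, a standard tableau $T$ (with distinct entries) is \emph{$\lambda$-catabolizable} if its first row has at least $\lambda_1$ entries, the first $\lambda_1$ of them are the $\lambda_1$ smallest entries of $T$, and $P(xy)$ is $\widehat\lambda$-catabolizable,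 where $x$ is the first row of $T$ without its first $\lambda_1$ entries and $y$ is the row reading word of the remaining rows; the empty tableau is $\varnothing$-catabolizable. For every standard word $w$ there is a greatest partition $\lambda$ in dominance order such that $P(w)$ is $\lambda$-catabolizable; it is called the \emph{catabolizability} $\mathrm{ctype}(w)$. Let $Z^*_\lambda$ be the standard tableau of shape $\lambda$ with entries $1,\dots,\lambda_1$ in the first row, $\lambda_1+1,\dots,\lambda_1+\lambda_2$ in the second row, and so on (the standard tableau whose cocharge labeling has $0$'s in the first row, $1$'s in the second row, and so on). \textbf{Corollary.} The catabolizability $\mathrm{ctype}(w)$ is well defined for every standard word $w$, and $\mathrm{ctype}$ is the unique function $F$ from standard words (of all lengths) to partitions that is invariant under non-zero rotations and corotations, catabolism transformations, and Knuth transformations, and satisfies $F(\mathrm{rowword}(Z^*_\lambda))=\lambda$ for every partition $\lambda$. -/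

import Mathlib

namespace Catabolism

/-- A standard word: a word of some length `n` in which each of `1, …, n` occurs exactly once. -/
def StandardWord : Type := {w : List ℕ // w.Perm (List.range' 1 w.length)}

/-! ### Cocharge labeling -/

/-- The cocharge label of the number `i` in the standard word `w`: the number `1` has label `0`,
and `i + 1` has the label of `i`, plus one if `i + 1` stands to the left of `i` in `w`
(the value at the number `0`, which does not occur in `w`, is irrelevant). -/
def cochargeLabel (w : List ℕ) : ℕ → ℕ
  | 0 => 0
  | 1 => 0
  | i + 2 => cochargeLabel w (i + 1) + if w.idxOf (i + 2) < w.idxOf (i + 1) then 1 else 0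

/-- The cocharge labeling of a word: the word of the labels of its numbers. -/
def cochargeLabeling (w : List ℕ) : List ℕ := w.map (cochargeLabel w)

/-! ### The three kinds of transformations -/

/-- `v = a y` is a non-zero corotation of `u = y a` (equivalently, `u` is a non-zero rotation
of `v`). -/
def NonzeroCorotation (u v : List ℕ) : Prop :=
  ∃ (y : List ℕ) (a : ℕ), a ≠ 1 ∧ u = y ++ [a] ∧ v = a :: y ∧ 0 < cochargeLabel u a

/-- `v` is obtained from `u` by swapping two adjacent numbers whose cocharge labels in `u`
differ by more than one. -/
def CatabolismTransformation (u v : List ℕ) : Prop :=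
  ∃ (x y : List ℕ) (a b : ℕ), u = x ++ [a, b] ++ y ∧ v = x ++ [b, a] ++ y ∧
    1 < |(cochargeLabel u a : ℤ) - (cochargeLabel u b : ℤ)|

/-- `⋯ b a c ⋯ ↔ ⋯ b c a ⋯` and `⋯ a c b ⋯ ↔ ⋯ c a b ⋯` for `a < b < c`. -/
def KnuthTransformation (u v : List ℕ) : Prop :=
  ∃ (x y : List ℕ) (a b c : ℕ), a < b ∧ b < c ∧
    ((u = x ++ [b, a, c] ++ y ∧ v = x ++ [b, c, a] ++ y) ∨
     (u = x ++ [b, c, a] ++ y ∧ v = x ++ [b, a, c] ++ y) ∨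
     (u = x ++ [a, c, b] ++ y ∧ v = x ++ [c, a, b] ++ y) ∨
     (u = x ++ [c, a, b] ++ y ∧ v = x ++ [a, c, b] ++ y))

/-! ### Tableaux, given by the list of their rows from top to bottom (English notation) -/

/-- Row insertion of `a` into a single row; the second component is the bumped entry, if any. -/
def insertRow (a : ℕ) : List ℕ → List ℕ × Option ℕ
  | [] => ([a], none)
  | b :: r => if a < b then (a :: r, some b) else (b :: (insertRow a r).1, (insertRow a r).2)

/-- Schensted row insertion of `a` into a tableau. -/
def insertTableau : List (List ℕ) → ℕ → List (List ℕ)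
  | [], a => [[a]]
  | r :: T, a =>
    match (insertRow a r).2 with
    | none => (insertRow a r).1 :: T
    | some b => (insertRow a r).1 :: insertTableau T b

/-- The insertion tableau `P(w)` of a word. -/
def insertionTableau (w : List ℕ) : List (List ℕ) := w.foldl insertTableau []

/-- The row reading word: rows are read from bottom to top, each from left to right. -/
def rowWord (T : List (List ℕ)) : List ℕ := T.reverse.flatten

/-! ### Catabolizability -/

/-- The first row of a tableau (empty for the empty tableau). -/
def firstRow (T : List (List ℕ)) : List ℕ := T.headD []

/-- The `m`-catabolism: delete the first `m` entries of the first row, and take the insertion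
tableau of what is left of the first row followed by the row reading word of the other rows. -/
def cat (m : ℕ) (T : List (List ℕ)) : List (List ℕ) :=
  insertionTableau ((firstRow T).drop m ++ rowWord T.tail)

/-- `λ`-catabolizability of a standard tableau `T` (whose entries are distinct, but need not
be `1, …, n`), where `λ` is given as the list of its parts: the first row has at least `λ₁` entries,
its first `λ₁` entries are the `λ₁` smallest entries of `T`, that is, they are smaller than all
other entries of `T`, and the `λ₁`-catabolism of `T` is `(λ₂, λ₃, …)`-catabolizable. -/
def Catabolizable : List ℕ → List (List ℕ) → Prop
  | [], T => T = []
  | m :: l, T => m ≤ (firstRow T).length ∧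
      (∀ x ∈ (firstRow T).take m, ∀ y ∈ (firstRow T).drop m ++ rowWord T.tail, x < y) ∧
      Catabolizable l (cat m T)

/-- Dominance order on partitions of the same number: `μ ⊴ lam`. Partitions are Young diagrams,
with parts `rowLens`. -/
def DominatedBy (μ lam : YoungDiagram) : Prop :=
  μ.card = lam.card ∧ ∀ k : ℕ, (μ.rowLens.take k).sum ≤ (lam.rowLens.take k).sum

/-- `lam` is the dominance-greatest partition for which `T` is catabolizable. -/
def IsCatabolizability (T : List (List ℕ)) (lam : YoungDiagram) : Prop :=
  Catabolizable lam.rowLens T ∧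
    ∀ μ : YoungDiagram, Catabolizable μ.rowLens T → DominatedBy μ lam

open Classical in
/-- The catabolizability of a standard word, i.e. of its insertion tableau `P(w)`
(the empty partition if there were no greatest partition). -/
noncomputable def ctype (w : StandardWord) : YoungDiagram :=
  if h : ∃ lam, IsCatabolizability (insertionTableau w.1) lam then h.choose else ⊥

/-! ### The tableau `Z*_λ` -/

/-- Rows of lengths `l` filled row by row with `s + 1, s + 2, …`. -/
def fillRows : ℕ → List ℕ → List (List ℕ)
  | _, [] => []
  | s, m :: l => List.range' (s + 1) m :: fillRows (s + m) l

/-- The standard tableau `Z*_λ` of shape `λ` whose first row is `1, …, λ₁`, whose second row is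
`λ₁ + 1, …, λ₁ + λ₂`, and so on. Its cocharge labeling has `0` in the first row, `1` in
the second row, and so on. -/
def Zstar (lam : YoungDiagram) : List (List ℕ) := fillRows 0 lam.rowLens

theorem flatten_fillRows (s : ℕ) (l : List ℕ) :
    (fillRows s l).flatten = List.range' (s + 1) l.sum := by
  induction l generalizing s with
  | nil => simp [fillRows]
  | cons m l ih =>
    rw [fillRows, List.flatten_cons, ih, List.sum_cons, ← List.range'_append_1]
    congr 2
    omega

theorem rowWord_Zstar_standard (lam : YoungDiagram) :
    (rowWord (Zstar lam)).Perm (List.range' 1 (rowWord (Zstar lam)).length) := by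
  have h : (rowWord (Zstar lam)).Perm (List.range' 1 lam.rowLens.sum) := by
    have := (List.reverse_perm (Zstar lam)).flatten
    rwa [Zstar, flatten_fillRows, Nat.zero_add] at this
  have hl := h.length_eq
  rw [List.length_range'] at hl
  rwa [hl]

/-- The standard word `rowword(Z*_λ)`. -/
def ZstarWord (lam : YoungDiagram) : StandardWord :=
  ⟨rowWord (Zstar lam), rowWord_Zstar_standard lam⟩

/-! ### The characterizing properties -/

/-- A partition-valued statistic on standard words that is invariant under non-zero (co)rotations,
catabolism transformations and Knuth transformations, and has the value `λ` on
`rowword(Z*_λ)`. -/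
structure IsNormalizedInvariant (F : StandardWord → YoungDiagram) : Prop where
  corotation : ∀ u v : StandardWord, NonzeroCorotation u.1 v.1 → F u = F v
  catabolism : ∀ u v : StandardWord, CatabolismTransformation u.1 v.1 → F u = F v
  knuth : ∀ u v : StandardWord, KnuthTransformation u.1 v.1 → F u = F v
  normalized : ∀ lam : YoungDiagram, F (ZstarWord lam) = lam

end Catabolism

/-!
Write the labels of a standard word, each increased by one, in reverse order: this is the *queue*
of the word (`queue`, `StandardWord.labelQueue`). A standard word is determined by its queue
(`StandardWord.labelQueue_injective`), and `Eval` is an insertion algorithm on queues. Its state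
is a sequence of row lengths `ν 0 ≥ ν 1 ≥ ⋯` and a queue; the first number `c` of the queue is
removed, and a box is added to row `c` if row `c` is shorter than row `c - 1`, while otherwise
`c + 1` joins the end of the queue. Row `0` is not part of the result: its length `j` is the
*cap*, an upper bound for the first row of the resulting partition. With a cap larger than the
length of the word the result is the catabolizability of the word.

*Invariance.* A non-zero corotation moves the first number `c` of the queue to its end, as
`c + 1`, which is a step of the algorithm. Catabolism and Knuth transformations change the queue
by a `QueueMove`: two adjacent numbers that differ by at least two are exchanged, or a factor
`a (a + 1)` is exchanged with a number `a` or `a + 1` next to it. A case check shows that the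
algorithm maps both sides of such a move to the same rows, with remaining queues that are again
equal or related by a move (`evalN_move`).

*Relation to catabolizability.* A word is Knuth equivalent to `y r`, where `r` is the first row of
its insertion tableau and `y` is the reading word of the other rows. Let `z` be the number of
letters of label `0`; they begin the row `r`. With cap `j` and `k = min j z`, the algorithm fills
row `1` with `k` boxes, and what remains to be done is the algorithm with cap `k` for the
`k`-catabolism of the tableau (`Eval.catabolism`, `ZeroSplit.eval_cat`). So the result is a
partition for which the tableau is catabolizable (`exists_eval_catabolizable`), and a partition
starting with `m` for which the tableau is catabolizable is dominated, by induction, by the result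
for the cap `m`. It remains to see that the result grows in dominance order with the cap
(`eval_cap_mono_succ`). If the caps `m` and `m + 1` give different results, the words left after
filling row `1` differ in one letter of label `0` at the front, and removing such a letter takes
away exactly one box from the result (`Eval.remove`).

*Uniqueness.* The row lengths `ν` of a state are turned into the queue `rowsQueue K ν` of the word
whose labels are `⋯ 1 ⋯ 1 0 ⋯ 0`. Placing it in front of the queue of the state, each step of the
algorithm becomes a sequence of moves, followed by a non-zero corotation if no box is added
(`rowsQueue_insert`, `rowsQueue_rotate`). As moves of queues lift to standard words
(`exists_lift`), every standard word `w` is linked to `rowword(Z*_λ)`, where `λ` is the result of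
the algorithm for `w` (`exists_rowsQueue`).
-/

namespace Catabolism

/-! ### The insertion algorithm on queues -/

/-- The row lengths `ν` with one box added to row `c`. -/
def inc (ν : ℕ → ℕ) (c : ℕ) : ℕ → ℕ := Function.update ν c (ν c + 1)

theorem inc_self (ν : ℕ → ℕ) (c : ℕ) : inc ν c c = ν c + 1 := by simp [inc]

theorem inc_of_ne (ν : ℕ → ℕ) {c i : ℕ} (h : i ≠ c) : inc ν c i = ν i := by simp [inc, h]

theorem inc_apply (ν : ℕ → ℕ) (c i : ℕ) : inc ν c i = if i = c then ν i + 1 else ν i := by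
  by_cases h : i = c <;> simp [inc, h]

theorem inc_comm (ν : ℕ → ℕ) (a b : ℕ) : inc (inc ν a) b = inc (inc ν b) a := by
  funext i; simp only [inc_apply]; split_ifs <;> rfl

theorem inc_antitone {ν : ℕ → ℕ} (h : Antitone ν) {c : ℕ} (hc : ν c < ν (c - 1)) :
    Antitone (inc ν c) := by
  refine antitone_nat_of_succ_le fun i => ?_
  have : ν (i + 1) ≤ ν i := h (Nat.le_succ i)
  simp only [inc_apply]
  split_ifs with h1 h2 h2
  · omega
  · subst h1; simp at hc; omega
  · omega
  · exact this

/-- `EvalN n ν q ν'`: starting with row lengths `ν` and queue `q`, the insertion algorithm empties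
the queue in exactly `n` steps and ends with row lengths `ν'`. In a step, the first number `c` of
the queue becomes a box of row `c` if row `c` is shorter than row `c - 1`, and joins the end of
the queue as `c + 1` otherwise. (A number `0` is never inserted, since `0 - 1 = 0`.) -/
def EvalN : ℕ → (ℕ → ℕ) → List ℕ → (ℕ → ℕ) → Prop
  | 0, ν, q, ν' => q = [] ∧ ν = ν'
  | _ + 1, _, [], _ => False
  | n + 1, ν, c :: q, ν' =>
    if ν c < ν (c - 1) then EvalN n (inc ν c) q ν' else EvalN n ν (q ++ [c + 1]) ν'

theorem evalN_cons (n : ℕ) (ν : ℕ → ℕ) (c : ℕ) (q : List ℕ) (ν' : ℕ → ℕ) :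
    EvalN (n + 1) ν (c :: q) ν' ↔
      if ν c < ν (c - 1) then EvalN n (inc ν c) q ν' else EvalN n ν (q ++ [c + 1]) ν' := Iff.rfl

/-- `Eval ν q ν'`: starting with row lengths `ν` and queue `q`, the insertion algorithm terminates
with row lengths `ν'`. -/
def Eval (ν : ℕ → ℕ) (q : List ℕ) (ν' : ℕ → ℕ) : Prop := ∃ n, EvalN n ν q ν'

theorem EvalN.unique {n m : ℕ} {ν : ℕ → ℕ} {q : List ℕ} {ν₁ ν₂ : ℕ → ℕ}
    (h₁ : EvalN n ν q ν₁) (h₂ : EvalN m ν q ν₂) : ν₁ = ν₂ := by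
  induction n generalizing m ν q with
  | zero =>
    obtain ⟨rfl, rfl⟩ := h₁
    cases m with
    | zero => exact h₂.2
    | succ m => exact h₂.elim
  | succ n ih =>
    cases q with
    | nil => exact h₁.elim
    | cons c q =>
      cases m with
      | zero => simp [EvalN] at h₂
      | succ m =>
        rw [evalN_cons] at h₁ h₂
        split_ifs at h₁ h₂ with h
        · exact ih h₁ h₂
        · exact ih h₁ h₂

theorem Eval.unique {ν : ℕ → ℕ} {q : List ℕ} {ν₁ ν₂ : ℕ → ℕ}
    (h₁ : Eval ν q ν₁) (h₂ : Eval ν q ν₂) : ν₁ = ν₂ := by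
  obtain ⟨n, h₁⟩ := h₁
  obtain ⟨m, h₂⟩ := h₂
  exact h₁.unique h₂

theorem Eval.nil (ν : ℕ → ℕ) : Eval ν [] ν := ⟨0, rfl, rfl⟩

theorem Eval.insert {ν ν' : ℕ → ℕ} {c : ℕ} {q : List ℕ} (hc : ν c < ν (c - 1))
    (h : Eval (inc ν c) q ν') : Eval ν (c :: q) ν' := by
  obtain ⟨n, h⟩ := h
  exact ⟨n + 1, by rwa [evalN_cons, if_pos hc]⟩

theorem Eval.rotate {ν ν' : ℕ → ℕ} {c : ℕ} {q : List ℕ} (hc : ¬ ν c < ν (c - 1))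
    (h : Eval ν (q ++ [c + 1]) ν') : Eval ν (c :: q) ν' := by
  obtain ⟨n, h⟩ := h
  exact ⟨n + 1, by rwa [evalN_cons, if_neg hc]⟩

theorem eval_nil_iff {ν ν' : ℕ → ℕ} : Eval ν [] ν' ↔ ν = ν' :=
  ⟨fun h => (Eval.nil ν).unique h, fun h => h ▸ Eval.nil ν⟩

theorem Eval.of_cons {ν ν' : ℕ → ℕ} {c : ℕ} {q : List ℕ} (h : Eval ν (c :: q) ν') :
    (ν c < ν (c - 1) ∧ Eval (inc ν c) q ν') ∨
      (¬ ν c < ν (c - 1) ∧ Eval ν (q ++ [c + 1]) ν') := by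
  obtain ⟨n, h⟩ := h
  cases n with
  | zero => simp [EvalN] at h
  | succ n =>
    rw [evalN_cons] at h
    split_ifs at h with hc
    · exact Or.inl ⟨hc, n, h⟩
    · exact Or.inr ⟨hc, n, h⟩

/-- Induction along a terminating run of the insertion algorithm. -/
@[elab_as_elim]
theorem Eval.rec_on {P : ∀ {ν ν' : ℕ → ℕ} {q : List ℕ}, Eval ν q ν' → Prop}
    (nil : ∀ ν, P (Eval.nil ν))
    (insert : ∀ ν c q ν' (hc : ν c < ν (c - 1)) (h : Eval (inc ν c) q ν'), P h → P (h.insert hc))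
    (rotate : ∀ ν c q ν' (hc : ¬ ν c < ν (c - 1)) (h : Eval ν (q ++ [c + 1]) ν'),
      P h → P (h.rotate hc))
    {ν ν' : ℕ → ℕ} {q : List ℕ} (h : Eval ν q ν') : P h := by
  obtain ⟨n, hn⟩ := id h
  induction n generalizing ν q with
  | zero => obtain ⟨rfl, rfl⟩ := hn; exact nil ν
  | succ n ih =>
    cases q with
    | nil => exact hn.elim
    | cons c q =>
      rw [evalN_cons] at hn
      split_ifs at hn with hc
      · exact insert ν c q ν' hc ⟨n, hn⟩ (ih _ hn)
      · exact rotate ν c q ν' hc ⟨n, hn⟩ (ih _ hn)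

/-- The row lengths `ν`, shifted by one, below a row `0` of length `j`. -/
def consRow (j : ℕ) (ν : ℕ → ℕ) : ℕ → ℕ
  | 0 => j
  | i + 1 => ν i

theorem inc_consRow (j : ℕ) (ν : ℕ → ℕ) (c : ℕ) :
    inc (consRow j ν) (c + 1) = consRow j (inc ν c) := by
  funext i
  cases i with
  | zero => simp [inc_apply, consRow]
  | succ i => simp [inc_apply, consRow]

/-- The algorithm for numbers increased by one below a row `0` of length `j`: row `0` of `ν`
becomes row `1` and stays untouched. -/
theorem Eval.shift (j : ℕ) {ν ν' : ℕ → ℕ} {q : List ℕ} (h : Eval ν q ν')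
    (hq : ∀ c ∈ q, 1 ≤ c) : Eval (consRow j ν) (q.map (· + 1)) (consRow j ν') := by
  induction h using Eval.rec_on with
  | nil ν => exact Eval.nil _
  | insert ν c q ν' hc _ ih =>
    obtain ⟨d, rfl⟩ : ∃ d, c = d + 1 := ⟨c - 1, by have := hq c (by simp); omega⟩
    refine Eval.insert (by simpa [consRow] using hc) ?_
    rw [inc_consRow]
    exact ih fun c hc => hq c (by simp [hc])
  | rotate ν c q ν' hc _ ih =>
    obtain ⟨d, rfl⟩ : ∃ d, c = d + 1 := ⟨c - 1, by have := hq c (by simp); omega⟩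
    refine Eval.rotate (by simpa [consRow] using hc) ?_
    have := ih fun c hc => by
      rcases List.mem_append.1 hc with h | h
      · exact hq c (by simp [h])
      · simp at h; omega
    simpa using this

theorem Eval.rotate_append {ν ν' : ℕ → ℕ} {p q : List ℕ} (hp : ∀ c ∈ p, ¬ ν c < ν (c - 1))
    (h : Eval ν (q ++ p.map (· + 1)) ν') : Eval ν (p ++ q) ν' := by
  induction p generalizing q with
  | nil => simpa using h
  | cons c p ih =>
    refine Eval.rotate (hp c (by simp)) ?_
    have := ih (q := q ++ [c + 1]) (fun c hc => hp c (by simp [hc])) (by simpa using h)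
    simpa using this

theorem Eval.insert_replicate {j k m : ℕ} {ν ν' : ℕ → ℕ} {q : List ℕ} (hk : m + k ≤ j)
    (h : Eval (consRow j (consRow (m + k) ν)) q ν') :
    Eval (consRow j (consRow m ν)) (List.replicate k 1 ++ q) ν' := by
  induction k generalizing m with
  | zero => simpa using h
  | succ k ih =>
    refine Eval.insert (by simp [consRow]; omega) ?_
    have : inc (consRow j (consRow m ν)) 1 = consRow j (consRow (m + 1) ν) := by
      rw [inc_consRow]
      congr 1
      funext i
      cases i <;> simp [inc_apply, consRow]
    rw [this]
    exact ih (by omega) (by rwa [Nat.add_right_comm])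

/-! ### Local plactic moves -/

/-- The elementary moves of queues: exchange of two numbers that differ by at least two, and
exchange of a factor `a (a + 1)` with a number `a` or `a + 1` next to it. -/
inductive QueueMove : List ℕ → List ℕ → Prop
  | far (a b : ℕ) : a + 2 ≤ b → QueueMove [a, b] [b, a]
  | upper (a : ℕ) : QueueMove [a + 1, a, a + 1] [a, a + 1, a + 1]
  | lower (a : ℕ) : QueueMove [a, a + 1, a] [a, a, a + 1]

/-- A queue move does not change the result of the algorithm: the rows that the moved block fills
are the same before and after the move, and the blocks that it adds to the end of the queue are
equal or related by a move. -/
theorem evalN_move {n : ℕ} {ν ν' : ℕ → ℕ} {x y u v : List ℕ} (hν : Antitone ν)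
    (h : QueueMove u v) :
    EvalN n ν (x ++ u ++ y) ν' ↔ EvalN n ν (x ++ v ++ y) ν' := by
  induction n using Nat.strong_induction_on generalizing ν x y u v with
  | _ n ih =>
  cases x with
  | cons c x =>
    cases n with
    | zero => simp [EvalN]
    | succ n =>
      simp only [List.cons_append, evalN_cons]
      split_ifs with hc
      · exact ih n (by omega) (inc_antitone hν hc) h
      · have := ih n (by omega) (ν := ν) (x := x) (y := y ++ [c + 1]) hν h
        simpa using this
  | nil =>
    have key : ∀ (m : ℕ) (ν : ℕ → ℕ) (u v : List ℕ), m < n → Antitone ν →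
        QueueMove u v → (EvalN m ν (y ++ u) ν' ↔ EvalN m ν (y ++ v) ν') :=
      fun m ν u v hm hν h => by simpa using ih m hm (ν := ν) (x := y) (y := []) hν h
    cases h with
    | far a b hab =>
      rcases n with _ | _ | n
      · simp [EvalN]
      · simp only [List.nil_append, List.cons_append, evalN_cons]; split_ifs <;> simp [EvalN]
      have e1 : b ≠ a := by omega
      have e2 : b - 1 ≠ a := by omega
      have e3 : a ≠ b := by omega
      have e4 : a - 1 ≠ b := by omega
      simp only [List.nil_append, List.cons_append, evalN_cons, inc_of_ne _ e1, inc_of_ne _ e2,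
        inc_of_ne _ e3, inc_of_ne _ e4, inc_comm _ b a, List.append_assoc]
      split_ifs
      · rfl
      · rfl
      · rfl
      · exact key n ν [a + 1, b + 1] [b + 1, a + 1] (by omega) hν
          (QueueMove.far (a + 1) (b + 1) (by omega))
    | upper a =>
      rcases n with _ | _ | _ | n
      · simp [EvalN]
      · simp only [List.nil_append, List.cons_append, evalN_cons]; split_ifs <;> simp [EvalN]
      · simp only [List.nil_append, List.cons_append, evalN_cons]; split_ifs <;> simp [EvalN]
      have := key n ν _ _ (by omega) hν (QueueMove.upper (a + 1))
      rcases a with _ | a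
      all_goals
        simp only [List.nil_append, List.cons_append, evalN_cons, List.append_assoc, inc_apply,
          Nat.add_sub_cancel]
        simp
        split_ifs <;> first
          | omega
          | rfl
          | exact this
          | simp only [inc_comm _ 1 0]
          | simp only [inc_comm _ (a + 1 + 1) (a + 1)]
    | lower a =>
      rcases n with _ | _ | _ | n
      · simp [EvalN]
      · simp only [List.nil_append, List.cons_append, evalN_cons]; split_ifs <;> simp [EvalN]
      · simp only [List.nil_append, List.cons_append, evalN_cons]; split_ifs <;> simp [EvalN]
      have hle : ν (a + 1) ≤ ν a := hν (Nat.le_succ a)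
      have this : ∀ μ, Antitone μ → _ := fun μ hμ =>
        key n μ _ _ (by omega) hμ (QueueMove.lower (a + 1))
      rcases a with _ | a
      all_goals
        simp only [List.nil_append, List.cons_append, evalN_cons, List.append_assoc, inc_apply,
          Nat.add_sub_cancel]
        simp
        split_ifs <;> first
          | omega
          | rfl
          | exact this _ hν
          | exact this _ (inc_antitone hν (by simpa using ‹_›))
          | simp only [inc_comm _ 1 0]
          | simp only [inc_comm _ (a + 1 + 1) (a + 1)]

theorem Eval.move {ν ν' : ℕ → ℕ} {x y u v : List ℕ} (hν : Antitone ν) (h : QueueMove u v) :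
    Eval ν (x ++ u ++ y) ν' ↔ Eval ν (x ++ v ++ y) ν' :=
  exists_congr fun _ => evalN_move hν h

/-! ### Removing the last letter of the queue -/

/-- A box added to row `c` does not influence the insertion of numbers `≥ c + 2`. -/
theorem Eval.inc {ν ν' : ℕ → ℕ} {q : List ℕ} {c : ℕ} (h : Eval ν q ν')
    (hq : ∀ b ∈ q, c + 2 ≤ b) : Eval (inc ν c) q (inc ν' c) := by
  induction h using Eval.rec_on with
  | nil ν => exact Eval.nil _
  | insert ν b q ν' hb _ ih =>
    have := hq b (by simp)
    refine Eval.insert ?_ ?_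
    · rwa [inc_of_ne _ (by omega), inc_of_ne _ (by omega)]
    · rw [inc_comm]
      exact ih fun b hb => hq b (by simp [hb])
  | rotate ν b q ν' hb _ ih =>
    have := hq b (by simp)
    refine Eval.rotate ?_ ?_
    · rwa [inc_of_ne _ (by omega), inc_of_ne _ (by omega)]
    · refine ih fun d hd => ?_
      rcases List.mem_append.1 hd with h | h
      · exact hq d (by simp [h])
      · simp at h; omega

/-- Removing a number `c` from the queue takes away exactly one box from the result, if the rows
above row `c` are full (of the length `j` of row `0`), the numbers before `c` are at least `c`,
and those after it are at least `c + 1`, or at least `c + 2` unless row `c` is full. A number `c`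
before the removed one is inserted as long as row `c` is not full, so these conditions persist
during a run. When the turn of the removed number comes, either it is inserted and no number
`≤ c + 1` is left, or row `c` is full and `c + 1` is in the same situation. -/
theorem Eval.remove {ν νA : ℕ → ℕ} {q : List ℕ} (h : Eval ν q νA) :
    ∀ (j : ℕ) (q₁ e : List ℕ) (c : ℕ) (νB : ℕ → ℕ), q = q₁ ++ c :: e → 1 ≤ c → Antitone ν →
      (∀ i < c, ν i = j) → (∀ b ∈ q₁, c ≤ b) → (∀ b ∈ e, c + 1 ≤ b) →
      (ν c < j → ∀ b ∈ e, c + 2 ≤ b) → Eval ν (q₁ ++ e) νB →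
      ∃ d, 1 ≤ d ∧ νA = Catabolism.inc νB d := by
  induction h using Eval.rec_on with
  | nil ν => intro j q₁ e c νB hq; simp at hq
  | insert ν b q νA hb h ih =>
    intro j q₁ e c νB hq hc hν hj h₁ he he' hB
    cases q₁ with
    | nil =>
      obtain ⟨rfl, rfl⟩ : b = c ∧ q = e := by simpa using hq
      rw [hj (b - 1) (by omega)] at hb
      exact ⟨b, hc, h.unique (hB.inc (he' hb))⟩
    | cons b' q₁ =>
      obtain ⟨rfl, rfl⟩ : b = b' ∧ q = q₁ ++ c :: e := by simpa using hq
      have hbc : c ≤ b := h₁ b (by simp)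
      rcases hB.of_cons with ⟨_, hB⟩ | ⟨hb', _⟩
      · refine ih j q₁ e c νB rfl hc (inc_antitone hν hb) (fun i hi => ?_)
          (fun b hb => h₁ b (by simp [hb])) he (fun hlt => he' ?_) hB
        · rw [inc_of_ne _ (by omega), hj i hi]
        · rw [inc_apply] at hlt; split_ifs at hlt <;> omega
      · exact absurd hb hb'
  | rotate ν b q νA hb h ih =>
    intro j q₁ e c νB hq hc hν hj h₁ he he' hB
    cases q₁ with
    | nil =>
      obtain ⟨rfl, rfl⟩ : b = c ∧ q = e := by simpa using hq
      have h0 := hj (b - 1) (by omega)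
      have hle : ν b ≤ ν (b - 1) := hν (Nat.sub_le b 1)
      refine ih j q [] (b + 1) νB rfl (by omega) hν (fun i hi => ?_) he (by simp) (by simp)
        (by simpa using hB)
      rcases Nat.lt_succ_iff_lt_or_eq.1 hi with hi | rfl
      · exact hj i hi
      · omega
    | cons b' q₁ =>
      obtain ⟨rfl, rfl⟩ : b = b' ∧ q = q₁ ++ c :: e := by simpa using hq
      have hbc : c ≤ b := h₁ b (by simp)
      rcases hB.of_cons with ⟨hb', _⟩ | ⟨_, hB⟩
      · exact absurd hb' hb
      · refine ih j q₁ (e ++ [b + 1]) c νB (by simp) hc hν hj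
          (fun b hb => h₁ b (by simp [hb])) (fun d hd => ?_) (fun hlt d hd => ?_)
          (by simpa using hB)
        · rcases List.mem_append.1 hd with h | h
          · exact he d h
          · simp at h; omega
        · rcases List.mem_append.1 hd with h | h
          · exact he' hlt d h
          · have : b ≠ c := by
              rintro rfl
              rw [hj (b - 1) (by omega)] at hb
              exact hb hlt
            simp at h; omega

/-! ### Knuth equivalence of a word with the reading word of its insertion tableau -/

/-- Knuth equivalence of words: the relation generated by Knuth transformations, which are
symmetric. -/
abbrev KnuthEq : List ℕ → List ℕ → Prop := Relation.ReflTransGen KnuthTransformation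

theorem KnuthTransformation.append {u v : List ℕ} (h : KnuthTransformation u v) (p s : List ℕ) :
    KnuthTransformation (p ++ u ++ s) (p ++ v ++ s) := by
  obtain ⟨x, y, a, b, c, hab, hbc, h⟩ := h
  refine ⟨p ++ x, y ++ s, a, b, c, hab, hbc, ?_⟩
  rcases h with ⟨rfl, rfl⟩ | ⟨rfl, rfl⟩ | ⟨rfl, rfl⟩ | ⟨rfl, rfl⟩ <;> simp

theorem KnuthEq.append {u v : List ℕ} (h : KnuthEq u v) (p s : List ℕ) :
    KnuthEq (p ++ u ++ s) (p ++ v ++ s) := by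
  induction h with
  | refl => exact Relation.ReflTransGen.refl
  | tail _ h ih => exact ih.tail (h.append p s)

theorem KnuthTransformation.perm {u v : List ℕ} (h : KnuthTransformation u v) : u.Perm v := by
  obtain ⟨x, y, a, b, c, -, -, h⟩ := h
  rcases h with ⟨rfl, rfl⟩ | ⟨rfl, rfl⟩ | ⟨rfl, rfl⟩ | ⟨rfl, rfl⟩
  · exact ((List.Perm.refl x).append ((List.Perm.swap c a []).cons b)).append (List.Perm.refl y)
  · exact ((List.Perm.refl x).append ((List.Perm.swap a c []).cons b)).append (List.Perm.refl y)
  · exact ((List.Perm.refl x).append (List.Perm.swap c a [b])).append (List.Perm.refl y)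
  · exact ((List.Perm.refl x).append (List.Perm.swap a c [b])).append (List.Perm.refl y)

theorem KnuthEq.perm {u v : List ℕ} (h : KnuthEq u v) : u.Perm v := by
  induction h with
  | refl => exact List.Perm.refl _
  | tail _ h ih => exact ih.trans h.perm

theorem insertRow_none {a : ℕ} {r : List ℕ} (h : (insertRow a r).2 = none) :
    (insertRow a r).1 = r ++ [a] := by
  induction r with
  | nil => rfl
  | cons c r ih =>
    rw [insertRow] at h ⊢
    split_ifs at h ⊢ with hac
    simpa using ih h

/-- If inserting `a` into a row bumps `b`, the new row starts with a number smaller than `b`. -/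
theorem insertRow_some_head {a b : ℕ} {r : List ℕ} (h : (insertRow a r).2 = some b) :
    a < b ∧ b ∈ r ∧ ∃ d s, (insertRow a r).1 = d :: s ∧ d < b ∧ (d = a ∨ d ∈ r) := by
  induction r with
  | nil => simp [insertRow] at h
  | cons c r ih =>
    rw [insertRow] at h ⊢
    split_ifs at h ⊢ with hac
    · obtain rfl : c = b := by simpa using h
      exact ⟨hac, by simp, a, r, rfl, hac, Or.inl rfl⟩
    · obtain ⟨h1, h2, d, s, h3, h4, h5⟩ := ih h
      exact ⟨h1, by simp [h2], c, _, rfl, by omega, Or.inr (by simp)⟩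

/-- The inserted number moves left through the entries of the row behind the bumped one. -/
theorem knuthEq_bump_first {a c : ℕ} {r : List ℕ} (hac : a < c) (hr : (c :: r).Pairwise (· < ·)) :
    KnuthEq (c :: r ++ [a]) (c :: a :: r) := by
  induction r generalizing c with
  | nil => exact Relation.ReflTransGen.refl
  | cons d r ih =>
    have hcd : c < d := (List.pairwise_cons.1 hr).1 d (by simp)
    have h1 := (ih (hac.trans hcd) (List.pairwise_cons.1 hr).2).append [c] []
    refine Relation.ReflTransGen.tail (by simpa using h1) ?_
    exact ⟨[], r, a, c, d, hac, hcd, Or.inr (Or.inl ⟨by simp, by simp⟩)⟩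

theorem knuthEq_insertRow {a b : ℕ} {r : List ℕ} (hr : r.Pairwise (· < ·)) (ha : a ∉ r)
    (h : (insertRow a r).2 = some b) : KnuthEq (r ++ [a]) (b :: (insertRow a r).1) := by
  induction r with
  | nil => simp [insertRow] at h
  | cons c r ih =>
    have hr' := List.pairwise_cons.1 hr
    rw [insertRow] at h ⊢
    split_ifs at h ⊢ with hac
    · obtain rfl : c = b := by simpa using h
      exact knuthEq_bump_first hac hr
    · have hca : c < a := by simp at ha; omega
      obtain ⟨h1, h2, d, s, h3, h4, h5⟩ := insertRow_some_head h
      have ih := (ih hr'.2 (fun h => ha (by simp [h])) h).append [c] []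
      refine Relation.ReflTransGen.tail (by simpa using ih) ?_
      have hcd : c < d := by
        rcases h5 with rfl | h5
        · exact hca
        · exact hr'.1 d h5
      simp only [h3]
      exact ⟨[], s, c, d, b, hcd, h4, Or.inr (Or.inr (Or.inl ⟨by simp, by simp⟩))⟩

theorem pairwise_insertRow {a : ℕ} {r : List ℕ} (hr : r.Pairwise (· < ·)) (ha : a ∉ r) :
    (insertRow a r).1.Pairwise (· < ·) ∧ ∀ x ∈ (insertRow a r).1, x = a ∨ x ∈ r := by
  induction r with
  | nil => simp [insertRow]
  | cons c r ih =>
    have hr' := List.pairwise_cons.1 hr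
    obtain ⟨i1, i2⟩ := ih hr'.2 (fun h => ha (by simp [h]))
    rw [insertRow]
    split_ifs with hac
    · refine ⟨List.pairwise_cons.2 ⟨fun x hx => hac.trans (hr'.1 x hx), hr'.2⟩, ?_⟩
      simp; tauto
    · have hca : c < a := by simp at ha; omega
      refine ⟨List.pairwise_cons.2 ⟨fun x hx => ?_, i1⟩, fun x hx => ?_⟩
      · rcases i2 x hx with rfl | h
        · exact hca
        · exact hr'.1 x h
      · rcases List.mem_cons.1 hx with rfl | hx
        · simp
        · rcases i2 x hx with rfl | h <;> simp [*]

theorem rowWord_cons (r : List ℕ) (T : List (List ℕ)) : rowWord (r :: T) = rowWord T ++ r := by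
  simp [rowWord]

theorem insertTableau_spec {T : List (List ℕ)} {a : ℕ} (hT : ∀ r ∈ T, r.Pairwise (· < ·))
    (ha : a ∉ rowWord T) (hnd : (rowWord T).Nodup) :
    KnuthEq (rowWord T ++ [a]) (rowWord (insertTableau T a)) ∧
      ∀ r ∈ insertTableau T a, r.Pairwise (· < ·) := by
  induction T generalizing a with
  | nil =>
    exact ⟨by simpa [rowWord, insertTableau] using Relation.ReflTransGen.refl,
      by simp [insertTableau]⟩
  | cons r T ih =>
    rw [rowWord_cons] at ha hnd
    have har : a ∉ r := fun h => ha (by simp [h])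
    have hr := hT r (by simp)
    have hT' : ∀ r ∈ T, r.Pairwise (· < ·) := fun r h => hT r (by simp [h])
    obtain ⟨p1, p2⟩ := pairwise_insertRow hr har
    rw [insertTableau, rowWord_cons]
    cases h : (insertRow a r).2 with
    | none =>
      refine ⟨?_, ?_⟩
      · rw [rowWord_cons, insertRow_none h, List.append_assoc]
      · simpa [p1] using hT'
    | some b =>
      have hb := (insertRow_some_head h).2.1
      have hnd' := List.nodup_append.1 hnd
      obtain ⟨i1, i2⟩ := ih hT' (a := b) (fun h' => hnd'.2.2 b h' b hb rfl) hnd'.1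
      refine ⟨?_, ?_⟩
      · rw [rowWord_cons]
        have h1 := (knuthEq_insertRow hr har h).append (rowWord T) []
        have h2 := i1.append [] (insertRow a r).1
        refine Relation.ReflTransGen.trans (by simpa using h1) ?_
        simpa using h2
      · simpa [p1] using i2

/-- A word with distinct letters is Knuth equivalent to the reading word of its insertion tableau,
and the rows of this tableau are increasing. -/
theorem insertionTableau_spec {w : List ℕ} (hw : w.Nodup) :
    KnuthEq w (rowWord (insertionTableau w)) ∧
      ∀ r ∈ insertionTableau w, r.Pairwise (· < ·) := by
  induction w using List.reverseRecOn with
  | nil => exact ⟨Relation.ReflTransGen.refl, by simp [insertionTableau]⟩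
  | append_singleton w a ih =>
    have hnd := List.nodup_append.1 hw
    obtain ⟨i1, i2⟩ := ih hnd.1
    have hp := i1.perm
    have ha : a ∉ rowWord (insertionTableau w) := fun h =>
      hnd.2.2 a (hp.mem_iff.2 h) a (by simp) rfl
    obtain ⟨j1, j2⟩ := insertTableau_spec i2 ha (hp.nodup_iff.1 hnd.1)
    have e : insertionTableau (w ++ [a]) = insertTableau (insertionTableau w) a := by
      simp [insertionTableau]
    rw [e]
    exact ⟨Relation.ReflTransGen.trans (by simpa using i1.append [] [a]) j1, j2⟩

theorem insertTableau_head {T : List (List ℕ)} {a : ℕ} (ha : a ∉ rowWord T)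
    (hT : T = [] ∨ ∃ m r T', T = (m :: r) :: T' ∧ ∀ x ∈ rowWord T, m ≤ x)
    (hperm : (rowWord T ++ [a]).Perm (rowWord (insertTableau T a))) :
    ∃ m r T', insertTableau T a = (m :: r) :: T' ∧ ∀ x ∈ rowWord (insertTableau T a), m ≤ x := by
  rcases hT with rfl | ⟨m, r, T', rfl, hm⟩
  · exact ⟨a, [], [], rfl, by simp [insertTableau, rowWord]⟩
  · have key : ∃ s, (insertRow a (m :: r)).1 = min a m :: s := by
      rw [insertRow]
      split_ifs with h
      · exact ⟨r, by simp [h.le]⟩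
      · exact ⟨(insertRow a r).1, by simp [not_lt.1 h]⟩
    obtain ⟨s, hs⟩ := key
    have : ∃ T'', insertTableau ((m :: r) :: T') a = (min a m :: s) :: T'' := by
      rw [insertTableau, hs]
      cases (insertRow a (m :: r)).2 <;> exact ⟨_, rfl⟩
    obtain ⟨T'', hT''⟩ := this
    refine ⟨min a m, s, T'', hT'', fun x hx => ?_⟩
    rcases List.mem_append.1 (hperm.mem_iff.2 hx) with h | h
    · exact (min_le_right _ _).trans (hm x h)
    · simp at h; simp [h]

/-- The smallest letter of a word is the first entry of the first row of its insertion tableau. -/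
theorem insertionTableau_head {w : List ℕ} (hw : w.Nodup) (hne : w ≠ []) :
    ∃ m r T', insertionTableau w = (m :: r) :: T' ∧
      ∀ x ∈ rowWord (insertionTableau w), m ≤ x := by
  induction w using List.reverseRecOn with
  | nil => exact absurd rfl hne
  | append_singleton w a ih =>
    have hnd := List.nodup_append.1 hw
    obtain ⟨i1, i2⟩ := insertionTableau_spec hnd.1
    have hp := i1.perm
    have ha : a ∉ rowWord (insertionTableau w) := fun h =>
      hnd.2.2 a (hp.mem_iff.2 h) a (by simp) rfl
    have hs := (insertTableau_spec i2 ha (hp.nodup_iff.1 hnd.1)).1.perm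
    have e : insertionTableau (w ++ [a]) = insertTableau (insertionTableau w) a := by
      simp [insertionTableau]
    rw [e]
    refine insertTableau_head ha ?_ hs
    by_cases hw0 : w = []
    · subst hw0; exact Or.inl rfl
    · exact Or.inr (ih hnd.1 hw0)

/-! ### Labelings -/

/-- `ℓ` is the cocharge labeling of the word `w` with distinct letters, which need not be
`1, …, n`: the smallest letter has label `0`, and if `t` is the next larger letter after `s`, then
`t` has the label of `s`, plus one if `t` stands to the left of `s`. The values of `ℓ` at numbers
that do not occur in `w` are arbitrary. -/
structure IsLabeling (w : List ℕ) (ℓ : ℕ → ℕ) : Prop where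
  zero : ∀ t ∈ w, (∀ s ∈ w, t ≤ s) → ℓ t = 0
  succ : ∀ s ∈ w, ∀ t ∈ w, s < t → (∀ r ∈ w, r ≤ s ∨ t ≤ r) →
    ℓ t = ℓ s + if w.idxOf t < w.idxOf s then 1 else 0

/-- Labels increase weakly with the letters, and letters with the same label increase from left to
right. -/
theorem IsLabeling.mono {w : List ℕ} {ℓ : ℕ → ℕ} (h : IsLabeling w ℓ) {s t : ℕ} (hs : s ∈ w)
    (ht : t ∈ w) (hst : s < t) : ℓ s ≤ ℓ t ∧ (ℓ s = ℓ t → w.idxOf s < w.idxOf t) := by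
  induction hn : t - s using Nat.strong_induction_on generalizing s t with
  | _ n ih =>
  by_cases hc : ∀ r ∈ w, r ≤ s ∨ t ≤ r
  · have := h.succ s hs t ht hst hc
    have hne : w.idxOf s ≠ w.idxOf t := fun e => hst.ne ((List.idxOf_inj hs).1 e)
    split_ifs at this with h' <;> exact ⟨by omega, fun e => by omega⟩
  · push Not at hc
    obtain ⟨r, hr, h1, h2⟩ := hc
    obtain ⟨i1, i2⟩ := ih _ (by omega) hs hr h1 rfl
    obtain ⟨j1, j2⟩ := ih _ (by omega) hr ht h2 rfl
    exact ⟨i1.trans j1, fun e => (i2 (by omega)).trans (j2 (by omega))⟩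

theorem IsLabeling.lt_of_idxOf_lt {w : List ℕ} {ℓ : ℕ → ℕ} (h : IsLabeling w ℓ) {s t : ℕ}
    (hs : s ∈ w) (ht : t ∈ w) (hst : s < t) (hi : w.idxOf t < w.idxOf s) : ℓ s < ℓ t := by
  obtain ⟨h1, h2⟩ := h.mono hs ht hst
  rcases h1.lt_or_eq with h1 | h1
  · exact h1
  · have := h2 h1; omega

theorem idxOf_lt_idxOf_of_nodup {p s : List ℕ} {b a : ℕ} (h : (p ++ b :: s).Nodup) (ha : a ∈ s) :
    (p ++ b :: s).idxOf b < (p ++ b :: s).idxOf a := by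
  obtain ⟨-, h2, h3⟩ := List.nodup_append.1 h
  rw [List.idxOf_append_of_notMem (fun hb => h3 b hb b (by simp) rfl),
    List.idxOf_append_of_notMem (fun hb => h3 a hb a (by simp [ha]) rfl), List.idxOf_cons_self]
  have : b ≠ a := by rintro rfl; exact (List.nodup_cons.1 h2).1 ha
  rw [List.idxOf_cons_ne _ this]
  omega

theorem idxOf_swap_lt {x y : List ℕ} {p q s t : ℕ} (hst : ¬ (s = p ∧ t = q))
    (hst' : ¬ (s = q ∧ t = p)) :
    (x ++ [p, q] ++ y).idxOf t < (x ++ [p, q] ++ y).idxOf s ↔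
      (x ++ [q, p] ++ y).idxOf t < (x ++ [q, p] ++ y).idxOf s := by
  have e : ∀ p q t : ℕ, (x ++ [p, q] ++ y).idxOf t = if t ∈ x then x.idxOf t else
      x.length + if t = p then 0 else if t = q then 1 else y.idxOf t + 2 := by
    intro p q t
    rw [List.append_assoc, List.idxOf_append]
    split_ifs with h1 h2 h3
    · rfl
    · subst h2; simp
    · subst h3; simp [List.idxOf_cons_ne _ (Ne.symm h2)]; omega
    · simp [List.idxOf_cons_ne _ (Ne.symm h2), List.idxOf_cons_ne _ (Ne.symm h3)]; omega
  have hx : ∀ t ∈ x, x.idxOf t < x.length := fun t ht => List.idxOf_lt_length_iff.2 ht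
  rw [e, e, e, e]
  by_cases hs : s ∈ x <;> by_cases ht : t ∈ x <;> simp only [hs, ht, if_true, if_false]
  · have := hx s hs
    split_ifs <;> omega
  · have := hx t ht
    split_ifs <;> omega
  · split_ifs <;> omega

/-- Exchanging two adjacent letters keeps the labeling if the letters are not consecutive in
size. -/
theorem IsLabeling.swap {x y : List ℕ} {p q : ℕ} {ℓ : ℕ → ℕ} (h : IsLabeling (x ++ [p, q] ++ y) ℓ)
    (hpq : ∃ r ∈ x ++ [p, q] ++ y, min p q < r ∧ r < max p q) :
    IsLabeling (x ++ [q, p] ++ y) ℓ := by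
  have hmem : ∀ t, t ∈ x ++ [q, p] ++ y ↔ t ∈ x ++ [p, q] ++ y := by
    intro t; simp; tauto
  refine ⟨fun t ht hm => h.zero t ((hmem t).1 ht) fun s hs => hm s ((hmem s).2 hs), ?_⟩
  intro s hs t ht hst hc
  rw [h.succ s ((hmem s).1 hs) t ((hmem t).1 ht) hst fun r hr => hc r ((hmem r).2 hr)]
  congr 1
  refine if_congr (idxOf_swap_lt ?_ ?_) rfl rfl
  all_goals
    rintro ⟨rfl, rfl⟩
    obtain ⟨r, hr, h1, h2⟩ := hpq
    have := hc r ((hmem r).2 hr)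
    simp [hst.le] at h1 h2
    omega

/-- Letters whose labels differ by more than one are not consecutive in size. -/
theorem IsLabeling.exists_between {w : List ℕ} {p q : ℕ} {ℓ : ℕ → ℕ} (h : IsLabeling w ℓ)
    (hp : p ∈ w) (hq : q ∈ w) (hpq : 1 < |(ℓ p : ℤ) - (ℓ q : ℤ)|) :
    ∃ r ∈ w, min p q < r ∧ r < max p q := by
  by_contra! hc
  rcases lt_trichotomy p q with hlt | rfl | hlt
  · have := h.succ p hp q hq hlt fun r hr => by
      have := hc r hr; simp [hlt.le] at this; omega
    rw [this] at hpq
    split_ifs at hpq <;> simp at hpq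
  · simp at hpq
  · have := h.succ q hq p hp hlt fun r hr => by
      have := hc r hr; simp [hlt.le] at this; omega
    rw [this] at hpq
    split_ifs at hpq <;> simp at hpq

/-- The queue of a word `w` with labeling `ℓ`: the labels, increased by one, from right to
left. -/
def queue (ℓ : ℕ → ℕ) (w : List ℕ) : List ℕ := (w.map fun t => ℓ t + 1).reverse

theorem queue_append (ℓ : ℕ → ℕ) (u v : List ℕ) : queue ℓ (u ++ v) = queue ℓ v ++ queue ℓ u := by
  simp [queue]

theorem queue_congr {ℓ ℓ' : ℕ → ℕ} {w : List ℕ} (h : ∀ t ∈ w, ℓ t = ℓ' t) :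
    queue ℓ w = queue ℓ' w := by
  rw [queue, queue, List.map_congr_left fun t ht => by rw [h t ht]]

theorem one_le_of_mem_queue {ℓ : ℕ → ℕ} {w : List ℕ} {c : ℕ} (h : c ∈ queue ℓ w) : 1 ≤ c := by
  simp only [queue, List.mem_reverse, List.mem_map] at h
  obtain ⟨t, -, rfl⟩ := h
  omega

/-- `p` and `q` differ by a move, in either direction, of a block of adjacent numbers. -/
def QueueStep (p q : List ℕ) : Prop :=
  ∃ x y u v, p = x ++ u ++ y ∧ q = x ++ v ++ y ∧ (QueueMove u v ∨ QueueMove v u)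

theorem QueueStep.symm {p q : List ℕ} (h : QueueStep p q) : QueueStep q p := by
  obtain ⟨x, y, u, v, h1, h2, h3⟩ := h
  exact ⟨x, y, v, u, h2, h1, h3.symm⟩

theorem QueueStep.eval_iff {p q : List ℕ} (h : QueueStep p q) {ν ν' : ℕ → ℕ} (hν : Antitone ν) :
    Eval ν p ν' ↔ Eval ν q ν' := by
  obtain ⟨x, y, u, v, rfl, rfl, h | h⟩ := h
  · exact Eval.move hν h
  · exact (Eval.move hν h).symm

theorem queueStep_of_move {ℓ : ℕ → ℕ} {x y m m' : List ℕ}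
    (h : QueueMove (queue ℓ m) (queue ℓ m') ∨ QueueMove (queue ℓ m') (queue ℓ m)) :
    QueueStep (queue ℓ (x ++ m ++ y)) (queue ℓ (x ++ m' ++ y)) :=
  ⟨queue ℓ y, queue ℓ x, _, _, by simp [queue_append], by simp [queue_append], h⟩

theorem queueStep_far {ℓ : ℕ → ℕ} {x y : List ℕ} {p q : ℕ} (h : ℓ p + 2 ≤ ℓ q ∨ ℓ q + 2 ≤ ℓ p) :
    QueueStep (queue ℓ (x ++ [p, q] ++ y)) (queue ℓ (x ++ [q, p] ++ y)) := by
  refine queueStep_of_move ?_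
  rcases h with h | h
  · exact Or.inr (QueueMove.far (ℓ p + 1) (ℓ q + 1) (by omega))
  · exact Or.inl (QueueMove.far (ℓ q + 1) (ℓ p + 1) (by omega))

/-- As `a` stands to the right of `b`, the label of `b` is larger than that of `a`; so the labels
of `a` and `c` differ by at least two, or those of `b` and `c` are equal. -/
theorem IsLabeling.knuth_bac {x y : List ℕ} {a b c : ℕ} {ℓ : ℕ → ℕ} (hab : a < b) (hbc : b < c)
    (hw : (x ++ [b, a, c] ++ y).Nodup) (h : IsLabeling (x ++ [b, a, c] ++ y) ℓ) :
    IsLabeling (x ++ [b, c, a] ++ y) ℓ ∧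
      QueueStep (queue ℓ (x ++ [b, a, c] ++ y)) (queue ℓ (x ++ [b, c, a] ++ y)) := by
  have e : ∀ p q, x ++ [b, p, q] ++ y = (x ++ [b]) ++ [p, q] ++ y := by simp
  refine ⟨?_, ?_⟩
  · rw [e] at h ⊢
    exact h.swap ⟨b, by simp, by simp; omega, by simp; omega⟩
  · have hidx : (x ++ [b, a, c] ++ y).idxOf b < (x ++ [b, a, c] ++ y).idxOf a := by
      have e' : x ++ [b, a, c] ++ y = x ++ b :: (a :: c :: y) := by simp
      rw [e'] at hw ⊢
      exact idxOf_lt_idxOf_of_nodup hw (by simp)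
    have h1 := h.lt_of_idxOf_lt (by simp) (by simp) hab hidx
    have h2 := (h.mono (by simp) (by simp) hbc).1
    by_cases hfar : ℓ a + 2 ≤ ℓ c
    · rw [e, e]; exact queueStep_far (Or.inl hfar)
    · refine queueStep_of_move (Or.inl ?_)
      have hb : ℓ b = ℓ a + 1 := by omega
      have hc : ℓ c = ℓ a + 1 := by omega
      simpa [queue, hb, hc] using QueueMove.upper (ℓ a + 1)

/-- As `b` stands to the right of `c`, the label of `c` is larger than that of `b`; so the labels
of `a` and `c` differ by at least two, or those of `a` and `b` are equal. -/
theorem IsLabeling.knuth_acb {x y : List ℕ} {a b c : ℕ} {ℓ : ℕ → ℕ} (hab : a < b) (hbc : b < c)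
    (hw : (x ++ [a, c, b] ++ y).Nodup) (h : IsLabeling (x ++ [a, c, b] ++ y) ℓ) :
    IsLabeling (x ++ [c, a, b] ++ y) ℓ ∧
      QueueStep (queue ℓ (x ++ [a, c, b] ++ y)) (queue ℓ (x ++ [c, a, b] ++ y)) := by
  have e : ∀ p q, x ++ [p, q, b] ++ y = x ++ [p, q] ++ (b :: y) := by simp
  refine ⟨?_, ?_⟩
  · rw [e] at h ⊢
    exact h.swap ⟨b, by simp, by simp; omega, by simp; omega⟩
  · have hidx : (x ++ [a, c, b] ++ y).idxOf c < (x ++ [a, c, b] ++ y).idxOf b := by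
      have e' : x ++ [a, c, b] ++ y = (x ++ [a]) ++ c :: (b :: y) := by simp
      rw [e'] at hw ⊢
      exact idxOf_lt_idxOf_of_nodup hw (by simp)
    have h1 := h.lt_of_idxOf_lt (by simp) (by simp) hbc hidx
    have h2 := (h.mono (by simp) (by simp) hab).1
    by_cases hfar : ℓ a + 2 ≤ ℓ c
    · rw [e, e]; exact queueStep_far (Or.inl hfar)
    · refine queueStep_of_move (Or.inl ?_)
      have hb : ℓ b = ℓ a := by omega
      have hc : ℓ c = ℓ a + 1 := by omega
      simpa [queue, hb, hc] using QueueMove.lower (ℓ a + 1)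

theorem IsLabeling.knuth {u v : List ℕ} {ℓ : ℕ → ℕ} (hu : u.Nodup) (h : IsLabeling u ℓ)
    (huv : KnuthTransformation u v) :
    IsLabeling v ℓ ∧ QueueStep (queue ℓ u) (queue ℓ v) := by
  have hv : v.Nodup := huv.perm.nodup_iff.1 hu
  obtain ⟨x, y, a, b, c, hab, hbc, hh⟩ := huv
  rcases hh with ⟨rfl, rfl⟩ | ⟨rfl, rfl⟩ | ⟨rfl, rfl⟩ | ⟨rfl, rfl⟩
  · exact h.knuth_bac hab hbc hu
  · have hv' : IsLabeling (x ++ [b, a, c] ++ y) ℓ := by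
      have e : ∀ p q, x ++ [b, p, q] ++ y = (x ++ [b]) ++ [p, q] ++ y := by simp
      rw [e] at h ⊢
      exact h.swap ⟨b, by simp, by simp; omega, by simp; omega⟩
    exact ⟨hv', (hv'.knuth_bac hab hbc hv).2.symm⟩
  · exact h.knuth_acb hab hbc hu
  · have hv' : IsLabeling (x ++ [a, c, b] ++ y) ℓ := by
      have e : ∀ p q, x ++ [p, q, b] ++ y = x ++ [p, q] ++ (b :: y) := by simp
      rw [e] at h ⊢
      exact h.swap ⟨b, by simp, by simp; omega, by simp; omega⟩
    exact ⟨hv', (hv'.knuth_acb hab hbc hv).2.symm⟩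

theorem IsLabeling.knuthEq {u v : List ℕ} {ℓ : ℕ → ℕ} (hu : u.Nodup) (h : IsLabeling u ℓ)
    (huv : KnuthEq u v) : IsLabeling v ℓ ∧
      ∀ ν ν', Antitone ν → (Eval ν (queue ℓ u) ν' ↔ Eval ν (queue ℓ v) ν') := by
  induction huv with
  | refl => exact ⟨h, fun _ _ _ => Iff.rfl⟩
  | tail h1 h2 ih =>
    obtain ⟨i1, i2⟩ := ih.1.knuth ((KnuthEq.perm h1).nodup_iff.1 hu) h2
    exact ⟨i1, fun ν ν' hν => (ih.2 ν ν' hν).trans (i2.eval_iff hν)⟩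

/-! ### Catabolism and labels -/

/-- When zero labels `s` at the beginning of the first row `s x` are removed and the rest `x` of
the row moves to the front, the labels of the letters of `x` grow by one relative to those of `y`.
As the smallest label is again `0`, the labels of `x` stay and those of `y` decrease by one. -/
theorem IsLabeling.catabolism {y s x : List ℕ} {ℓ : ℕ → ℕ} (hnd : (y ++ (s ++ x)).Nodup)
    (h : IsLabeling (y ++ (s ++ x)) ℓ) (hr : (s ++ x).Pairwise (· < ·)) (hs : ∀ t ∈ s, ℓ t = 0)
    (hy : ∀ t ∈ y, 1 ≤ ℓ t) :
    IsLabeling (x ++ y) fun t => if t ∈ y then ℓ t - 1 else ℓ t := by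
  obtain ⟨-, hsx, hdy⟩ := List.nodup_append.1 hnd
  obtain ⟨-, -, hdx⟩ := List.nodup_append.1 hsx
  obtain ⟨hrs, hrx, hrsx⟩ := List.pairwise_append.1 hr
  have hxy : ∀ t ∈ x, t ∉ y := fun t ht h => hdy t h t (by simp [ht]) rfl
  have hyx : ∀ t ∈ y, t ∉ x := fun t ht h => hxy t h ht
  have hys : ∀ t ∈ y, t ∉ s := fun t ht h => hdy t ht t (by simp [h]) rfl
  have hxs : ∀ t ∈ x, t ∉ s := fun t ht h => hdx t h t ht rfl
  have hsub : ∀ t ∈ x ++ y, t ∈ y ++ (s ++ x) := by intro t; simp; tauto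
  have hmin : ∀ t ∈ s, ∀ u ∈ x ++ y, t < u := by
    intro t ht u hu
    rcases List.mem_append.1 hu with hu | hu
    · exact hrsx t ht u hu
    · by_contra hlt
      have hne : u ≠ t := by rintro rfl; exact hys u hu ht
      have := (h.mono (s := u) (t := t) (by simp [hu]) (by simp [ht]) (by omega)).1
      have := hs t ht
      have := hy u hu
      omega
  have hi1 : ∀ t ∈ y, (y ++ (s ++ x)).idxOf t = y.idxOf t := fun t ht =>
    List.idxOf_append_of_mem ht
  have hi2 : ∀ t ∈ x, (y ++ (s ++ x)).idxOf t = y.length + (s.length + x.idxOf t) := fun t ht => by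
    rw [List.idxOf_append_of_notMem (hxy t ht), List.idxOf_append_of_notMem (hxs t ht)]
  have hi3 : ∀ t ∈ x, (x ++ y).idxOf t = x.idxOf t := fun t ht => List.idxOf_append_of_mem ht
  have hi4 : ∀ t ∈ y, (x ++ y).idxOf t = x.length + y.idxOf t := fun t ht =>
    List.idxOf_append_of_notMem (hyx t ht)
  have hly : ∀ t ∈ y, y.idxOf t < y.length := fun t ht => List.idxOf_lt_length_iff.2 ht
  have hlx : ∀ t ∈ x, x.idxOf t < x.length := fun t ht => List.idxOf_lt_length_iff.2 ht
  refine ⟨fun t ht hm => ?_, fun a ha b hb hab hc => ?_⟩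
  · rcases List.eq_nil_or_concat' s with rfl | ⟨s, m, rfl⟩
    · have := h.zero t (hsub t ht) fun u hu => hm u (by simp at hu ⊢; tauto)
      simp [this]
    · have hms : m ∈ s ++ [m] := by simp
      have := h.succ m (by simp) t (hsub t ht) (hmin m hms t ht) fun u hu => by
        simp only [List.mem_append] at hu
        by_cases hu' : u ∈ x ++ y
        · exact Or.inr (hm u hu')
        · simp only [List.mem_append] at hu'
          have hu : u ∈ s ∨ u ∈ [m] := by tauto
          rcases hu with hu | hu
          · exact Or.inl ((List.pairwise_append.1 hrs).2.2 u hu m (by simp)).le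
          · simp at hu; exact Or.inl hu.le
      rw [hs m hms] at this
      rcases List.mem_append.1 ht with ht | ht
      · simp only [hxy t ht, if_false]
        rw [this, if_neg]
        have hmy : m ∉ y := fun hm => hys m hm hms
        rw [hi2 t ht, List.idxOf_append_of_notMem hmy, List.idxOf_append_of_mem hms]
        have := List.idxOf_lt_length_iff.2 hms
        omega
      · simp only [ht, if_true]
        split_ifs at this <;> omega
  · have := h.succ a (hsub a ha) b (hsub b hb) hab fun u hu => by
      by_cases hu' : u ∈ x ++ y
      · exact hc u hu'
      · have hu : u ∈ s := by simp at hu hu'; tauto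
        exact Or.inl (hmin u hu a ha).le
    rcases List.mem_append.1 ha with ha | ha <;> rcases List.mem_append.1 hb with hb | hb
    · simp only [hxy a ha, hxy b hb, if_false]
      rw [this, hi2 a ha, hi2 b hb, hi3 a ha, hi3 b hb]
      simp
    · simp only [hxy a ha, hb, if_false, if_true]
      rw [this, hi2 a ha, hi1 b hb, hi3 a ha, hi4 b hb]
      have h1 := hly b hb
      have h2 := hlx a ha
      rw [if_pos (by omega), if_neg (by omega)]
      omega
    · simp only [ha, hxy b hb, if_false, if_true]
      rw [this, hi1 a ha, hi2 b hb, hi4 a ha, hi3 b hb]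
      have h1 := hly a ha
      have h2 := hlx b hb
      have h3 := hy a ha
      rw [if_neg (by omega), if_pos (by omega)]
      omega
    · simp only [ha, hb, if_true]
      rw [this, hi1 a ha, hi1 b hb, hi4 a ha, hi4 b hb]
      have h3 := hy a ha
      simp only [Nat.add_lt_add_iff_left]
      omega

/-- Row `0` of length `j`, the cap, above empty rows. -/
def capRow (j : ℕ) : ℕ → ℕ := consRow j fun _ => 0

theorem capRow_eq (j : ℕ) : capRow j = consRow j (consRow 0 fun _ => 0) := by
  rw [capRow]
  congr 1
  funext i
  cases i <;> rfl

theorem capRow_antitone (j : ℕ) : Antitone (capRow j) :=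
  antitone_nat_of_succ_le fun i => by simp [capRow, consRow]

/-- The first pass of the algorithm with cap `j`. The letters `x₁` are not inserted, since row `1`
is empty, then `s.length` of the zero labels fill row `1`, and the zero labels that are left, for
which the lemma requires that row `1` has reached the cap, join the end of the queue. -/
theorem Eval.catabolism {y s x₀ x₁ : List ℕ} {ℓ : ℕ → ℕ} {j : ℕ} {μ : ℕ → ℕ}
    (hnd : (y ++ (s ++ (x₀ ++ x₁))).Nodup) (hs : ∀ t ∈ s, ℓ t = 0) (hx₀ : ∀ t ∈ x₀, ℓ t = 0)
    (hx₁ : ∀ t ∈ x₁, 1 ≤ ℓ t) (hy : ∀ t ∈ y, 1 ≤ ℓ t) (hsj : s.length ≤ j)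
    (hx₀j : s.length = j ∨ x₀ = [])
    (h : Eval (capRow s.length)
      (queue (fun t => if t ∈ y then ℓ t - 1 else ℓ t) (x₀ ++ x₁ ++ y)) μ) :
    Eval (capRow j) (queue ℓ (y ++ (s ++ (x₀ ++ x₁)))) (consRow j μ) := by
  have hxy : ∀ t ∈ x₀ ++ x₁, t ∉ y := fun t ht h' =>
    (List.nodup_append.1 hnd).2.2 t h' t (by simp at ht ⊢; tauto) rfl
  have hrep : ∀ l : List ℕ, (∀ t ∈ l, ℓ t = 0) → queue ℓ l = List.replicate l.length 1 := by
    intro l hl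
    rw [List.eq_replicate_iff]
    refine ⟨by simp [queue], fun b hb => ?_⟩
    simp only [queue, List.mem_reverse, List.mem_map] at hb
    obtain ⟨t, ht, rfl⟩ := hb
    rw [hl t ht]
  have e₀ := queue_congr (ℓ := fun t => if t ∈ y then ℓ t - 1 else ℓ t) (ℓ' := ℓ) (w := x₀ ++ x₁)
    fun t ht => by simp [hxy t ht]
  have ey : (queue (fun t => if t ∈ y then ℓ t - 1 else ℓ t) y).map (· + 1) = queue ℓ y := by
    simp only [queue, List.map_reverse, List.map_map]
    congr 1
    refine List.map_congr_left fun t ht => ?_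
    have := hy t ht
    simp [ht]; omega
  have h' := h.shift j fun c hc => one_le_of_mem_queue hc
  rw [queue_append, e₀, List.map_append, ey, queue_append, hrep x₀ hx₀] at h'
  rw [queue_append, queue_append, queue_append, List.append_assoc, List.append_assoc]
  refine Eval.rotate_append (fun c hc => ?_) ?_
  · simp only [queue, List.mem_reverse, List.mem_map] at hc
    obtain ⟨t, ht, rfl⟩ := hc
    obtain ⟨d, hd⟩ := Nat.exists_eq_add_of_le (hx₁ t ht)
    rw [hd, show 1 + d + 1 = d + 2 by omega]
    simp [capRow, consRow]
  rw [hrep x₀ hx₀, hrep s hs, ← List.append_assoc, List.replicate_append_replicate,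
    Nat.add_comm, ← List.replicate_append_replicate, List.append_assoc, List.append_assoc]
  rw [capRow_eq]
  refine Eval.insert_replicate (by omega) ?_
  rw [Nat.zero_add]
  refine Eval.rotate_append (fun c hc => ?_) ?_
  · obtain ⟨hc0, rfl⟩ := List.mem_replicate.1 hc
    rcases hx₀j with hj | rfl
    · simp [consRow, hj]
    · simp at hc0
  · simpa [capRow] using h'

/-! ### The insertion algorithm computes the dominance-greatest partition -/

/-- The row lengths given by the list of the parts of a partition. -/
def rows (l : List ℕ) : ℕ → ℕ := fun i => l.getD i 0

theorem rows_nil : rows [] = fun _ => 0 := by funext i; simp [rows]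

theorem rows_cons (k : ℕ) (l : List ℕ) : rows (k :: l) = consRow k (rows l) := by
  funext i; cases i <;> simp [rows, consRow]

theorem sum_rows (l : List ℕ) (K : ℕ) :
    ∑ i ∈ Finset.range K, rows l i = (l.take K).sum := by
  induction l generalizing K with
  | nil => simp [rows_nil]
  | cons k l ih =>
    cases K with
    | zero => simp
    | succ K => rw [Finset.sum_range_succ', rows_cons]; simp [consRow, ih]; omega

theorem exists_length_zeros {r : List ℕ} {ℓ : ℕ → ℕ} (hr : r.Pairwise (fun s t => ℓ s ≤ ℓ t)) :
    ∃ z ≤ r.length, (∀ t ∈ r.take z, ℓ t = 0) ∧ ∀ t ∈ r.drop z, 1 ≤ ℓ t := by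
  induction r with
  | nil => exact ⟨0, le_rfl, by simp, by simp⟩
  | cons a r ih =>
    obtain ⟨h1, h2⟩ := List.pairwise_cons.1 hr
    by_cases ha : ℓ a = 0
    · obtain ⟨z, hz, hz1, hz2⟩ := ih h2
      exact ⟨z + 1, by simpa using hz, by simpa [ha] using hz1, by simpa using hz2⟩
    · refine ⟨0, by simp, by simp, fun t ht => ?_⟩
      rcases List.mem_cons.1 ht with rfl | ht
      · omega
      · have := h1 t ht; omega

/-- The word `w` and the reading word `y r` of a tableau with first row `r` have the same letters,
and the algorithm gives the same result for both; `ℓ` is the labeling of `y r`, and the first `z`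
entries of `r` are exactly the letters of label `0`. -/
structure ZeroSplit (w y r : List ℕ) (z : ℕ) (ℓ : ℕ → ℕ) : Prop where
  perm : w.Perm (y ++ r)
  nodup : (y ++ r).Nodup
  labeling : IsLabeling (y ++ r) ℓ
  eval_iff : ∀ ν ν', Antitone ν → (Eval ν (queue ℓ w) ν' ↔ Eval ν (queue ℓ (y ++ r)) ν')
  sorted : r.Pairwise (· < ·)
  one_le : 1 ≤ z
  le_length : z ≤ r.length
  take : ∀ t ∈ r.take z, ℓ t = 0
  drop : ∀ t ∈ r.drop z, 1 ≤ ℓ t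
  below : ∀ t ∈ y, 1 ≤ ℓ t

theorem exists_zeroSplit {w : List ℕ} {ℓ : ℕ → ℕ} (hw : w.Nodup) (hne : w ≠ [])
    (h : IsLabeling w ℓ) : ∃ z, ZeroSplit w (rowWord (insertionTableau w).tail)
      (firstRow (insertionTableau w)) z ℓ := by
  obtain ⟨hk, hs⟩ := insertionTableau_spec hw
  obtain ⟨m, r', T', hT, hm⟩ := insertionTableau_head hw hne
  have e1 : firstRow (insertionTableau w) = m :: r' := by rw [hT]; rfl
  have e2 : rowWord (insertionTableau w) =
      rowWord (insertionTableau w).tail ++ firstRow (insertionTableau w) := by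
    rw [hT, rowWord_cons]; rfl
  have hsr := hs (m :: r') (by simp [hT])
  rw [e2] at hk hm
  rw [e1] at hk hm ⊢
  generalize rowWord (insertionTableau w).tail = y at hk hm ⊢
  have hp := KnuthEq.perm hk
  have hnd := hp.nodup_iff.1 hw
  obtain ⟨hl, hev⟩ := h.knuthEq hw hk
  have hm0 : ℓ m = 0 := hl.zero m (by simp) hm
  obtain ⟨z, hz, hz1, hz2⟩ := exists_length_zeros (r := m :: r') (ℓ := ℓ)
    (hsr.imp_of_mem fun {s t} hs ht hst => (hl.mono (List.mem_append_right _ hs)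
      (List.mem_append_right _ ht) hst).1)
  have hz0 : 1 ≤ z := by
    by_contra hz0
    obtain rfl : z = 0 := by omega
    have := hz2 m (by simp)
    omega
  refine ⟨z, hp, hnd, hl, hev, hsr, hz0, hz, hz1, hz2, fun t ht => ?_⟩
  have hidx : (y ++ m :: r').idxOf t < (y ++ m :: r').idxOf m := by
    have : m ∉ y := fun h' => (List.nodup_append.1 hnd).2.2 m h' m (by simp) rfl
    rw [List.idxOf_append_of_mem ht, List.idxOf_append_of_notMem this]
    have := List.idxOf_lt_length_iff.2 ht
    omega
  have hmt : m < t := lt_of_le_of_ne (hm t (by simp [ht])) (by rintro rfl; omega)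
  have := hl.lt_of_idxOf_lt (by simp) (by simp [ht]) hmt hidx
  omega

/-- The labels after moving the rest of the first row in front of the reading word `y` of the
other rows. -/
def catLabel (ℓ : ℕ → ℕ) (y : List ℕ) : ℕ → ℕ := fun t => if t ∈ y then ℓ t - 1 else ℓ t

section

variable {w y r : List ℕ} {z : ℕ} {ℓ : ℕ → ℕ}

theorem ZeroSplit.take_of_le (h : ZeroSplit w y r z ℓ) {k : ℕ} (hk : k ≤ z) :
    ∀ t ∈ r.take k, ℓ t = 0 := fun t ht =>
  h.take t ((List.take_sublist_take_left hk).subset ht)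

theorem ZeroSplit.nodup_cat (h : ZeroSplit w y r z ℓ) (k : ℕ) : (r.drop k ++ y).Nodup := by
  have : (y ++ r.drop k).Nodup := h.nodup.sublist
    ((List.Sublist.refl y).append (List.drop_sublist k r))
  exact List.nodup_append_comm.1 this

theorem ZeroSplit.length_cat (h : ZeroSplit w y r z ℓ) {k : ℕ} (hk : k ≤ z) :
    (r.drop k ++ y).length + k = w.length := by
  have := h.perm.length_eq
  have := h.le_length
  simp at *
  omega

theorem ZeroSplit.labeling_cat (h : ZeroSplit w y r z ℓ) {k : ℕ} (hk : k ≤ z) :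
    IsLabeling (r.drop k ++ y) (catLabel ℓ y) := by
  refine IsLabeling.catabolism (s := r.take k) ?_ ?_ ?_ (h.take_of_le hk) h.below
  · rw [List.take_append_drop]; exact h.nodup
  · rw [List.take_append_drop]; exact h.labeling
  · rw [List.take_append_drop]; exact h.sorted

theorem ZeroSplit.eval_cat (h : ZeroSplit w y r z ℓ) {k j : ℕ} (hk : k ≤ z) (hkj : k ≤ j)
    (hkjz : k = j ∨ k = z) {μ : ℕ → ℕ}
    (hμ : Eval (capRow k) (queue (catLabel ℓ y) (r.drop k ++ y)) μ) :
    Eval (capRow j) (queue ℓ w) (consRow j μ) := by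
  rw [h.eval_iff _ _ (capRow_antitone j)]
  have hlen : (r.take k).length = k := by simp; exact hk.trans h.le_length
  have e : r.drop k = (r.drop k).take (z - k) ++ r.drop z := by
    have := (List.take_append_drop (z - k) (r.drop k)).symm
    rwa [List.drop_drop, Nat.add_sub_cancel' hk] at this
  have e' : r = r.take k ++ ((r.drop k).take (z - k) ++ r.drop z) := by
    rw [← e, List.take_append_drop]
  have := Eval.catabolism (y := y) (s := r.take k) (x₀ := (r.drop k).take (z - k))
    (x₁ := r.drop z) (ℓ := ℓ) (j := j) (μ := μ) (by rw [← e']; exact h.nodup) (h.take_of_le hk)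
    (fun t ht => h.take t ?_) h.drop h.below (by omega) ?_ ?_
  · rwa [← e'] at this
  · rw [← List.drop_take] at ht
    exact List.mem_of_mem_drop ht
  · rcases hkjz with rfl | rfl
    · exact Or.inl hlen
    · right; simp
  · rw [hlen, ← e]
    exact hμ

theorem ZeroSplit.lt_of_mem_take (h : ZeroSplit w y r z ℓ) {k : ℕ} (hk : k ≤ z) :
    ∀ s ∈ r.take k, ∀ t ∈ r.drop k ++ y, s < t := by
  intro s hs t ht
  rcases List.mem_append.1 ht with ht | ht
  · have := h.sorted
    rw [← List.take_append_drop k r] at this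
    exact (List.pairwise_append.1 this).2.2 s hs t ht
  · have h1 := h.take_of_le hk s hs
    have h2 := h.below t ht
    by_contra hlt
    have hne : s ≠ t := by rintro rfl; omega
    have := (h.labeling.mono (s := t) (t := s) (by simp [ht])
      (List.mem_append_right _ (List.mem_of_mem_take hs)) (by omega)).1
    omega

/-- If the first `m` entries of the first row are the smallest letters, then they have label `0`:
the first of them is the smallest letter, and neighbours among them are consecutive in size, so
they have the same label. -/
theorem ZeroSplit.le_of_lt (h : ZeroSplit w y r z ℓ) {m : ℕ} (hm : m ≤ r.length)
    (hlt : ∀ s ∈ r.take m, ∀ t ∈ r.drop m ++ y, s < t) : m ≤ z := by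
  by_contra hzm
  have hz := h.one_le
  have hzr : z < r.length := by omega
  have e : r = r.take (z - 1) ++ r[z - 1] :: r[z] :: r.drop (z + 1) := by
    have h1 := List.take_append_drop (z - 1) r
    rw [List.drop_eq_getElem_cons (by omega : z - 1 < r.length), Nat.sub_add_cancel hz,
      List.drop_eq_getElem_cons hzr] at h1
    exact h1.symm
  have ha : ℓ r[z - 1] = 0 := h.take _ (List.mem_take_iff_getElem.2 ⟨z - 1, by omega, rfl⟩)
  have hb : 1 ≤ ℓ r[z] := h.drop _ (by rw [List.drop_eq_getElem_cons hzr]; exact List.mem_cons_self)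
  have hbm : r[z] ∈ r.take m := List.mem_take_iff_getElem.2 ⟨z, by omega, rfl⟩
  have hsr := h.sorted
  have hnd := h.nodup
  have hl := h.labeling
  generalize r[z - 1] = a at *
  generalize r[z] = b at *
  have hsr' := hsr
  rw [e] at hsr'
  have hidx : (y ++ r).idxOf a < (y ++ r).idxOf b := by
    rw [e, ← List.append_assoc] at hnd ⊢
    exact idxOf_lt_idxOf_of_nodup hnd (by simp)
  obtain ⟨-, h2, h3⟩ := List.pairwise_append.1 hsr'
  obtain ⟨h4, h5⟩ := List.pairwise_cons.1 h2
  obtain ⟨h6, -⟩ := List.pairwise_cons.1 h5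
  have har : a ∈ r := by rw [e]; simp
  have hbr : b ∈ r := by rw [e]; simp
  have := hl.succ a (by simp [har]) b (by simp [hbr]) (h4 b (by simp)) fun u hu => by
    rcases List.mem_append.1 hu with hu | hu
    · exact Or.inr (hlt b hbm u (by simp [hu])).le
    · rw [e] at hu
      simp only [List.mem_append, List.mem_cons] at hu
      rcases hu with hu | rfl | rfl | hu
      · exact Or.inl (h3 u hu a (by simp)).le
      · exact Or.inl le_rfl
      · exact Or.inr le_rfl
      · exact Or.inr (h6 u hu).le
  rw [if_neg (by omega)] at this
  omega

end

/-- The algorithm with positive cap terminates, and a tableau is catabolizable for the result. -/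
theorem exists_eval_catabolizable {w : List ℕ} {ℓ : ℕ → ℕ} (hw : w.Nodup) (h : IsLabeling w ℓ)
    {j : ℕ} (hj : 1 ≤ j) :
    ∃ l : List ℕ, l.Pairwise (· ≥ ·) ∧ (∀ p ∈ l, 1 ≤ p ∧ p ≤ j) ∧
      Eval (capRow j) (queue ℓ w) (consRow j (rows l)) ∧ Catabolizable l (insertionTableau w) := by
  induction hn : w.length using Nat.strong_induction_on generalizing w ℓ j with
  | _ n ih =>
  by_cases hne : w = []
  · subst hne
    exact ⟨[], by simp, by simp, by rw [rows_nil]; exact Eval.nil _, rfl⟩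
  obtain ⟨z, hz⟩ := exists_zeroSplit hw hne h
  have hz1 := hz.one_le
  have hk1 : min j z ≤ z := min_le_right _ _
  have hk0 : 1 ≤ min j z := le_min hj hz1
  have hlen := hz.length_cat hk1
  obtain ⟨l, l1, l2, l3, l4⟩ := ih _ (by omega) (hz.nodup_cat (min j z)) (hz.labeling_cat hk1) hk0
    rfl
  refine ⟨min j z :: l, List.pairwise_cons.2 ⟨fun p hp => (l2 p hp).2, l1⟩, ?_, ?_, ?_⟩
  · intro p hp
    rcases List.mem_cons.1 hp with rfl | hp
    · exact ⟨hk0, min_le_left _ _⟩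
    · exact ⟨(l2 p hp).1, (l2 p hp).2.trans (min_le_left _ _)⟩
  · rw [rows_cons]
    refine hz.eval_cat hk1 (min_le_left _ _) ?_ l3
    rcases le_total j z with h | h
    · exact Or.inl (min_eq_left h)
    · exact Or.inr (min_eq_right h)
  · exact ⟨hk1.trans hz.le_length, hz.lt_of_mem_take hk1, l4⟩

/-- The result of the algorithm grows in dominance order when the cap grows by one. -/
theorem eval_cap_mono_succ {w : List ℕ} {ℓ : ℕ → ℕ} (hw : w.Nodup) (h : IsLabeling w ℓ)
    {m : ℕ} (hm : 1 ≤ m) {μ μ' : ℕ → ℕ} (hμ : Eval (capRow m) (queue ℓ w) μ)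
    (hμ' : Eval (capRow (m + 1)) (queue ℓ w) μ') (K : ℕ) :
    ∑ i ∈ Finset.range K, μ (i + 1) ≤ ∑ i ∈ Finset.range K, μ' (i + 1) := by
  induction hn : w.length using Nat.strong_induction_on generalizing w ℓ m μ μ' K with
  | _ n ih =>
  by_cases hne : w = []
  · subst hne
    obtain rfl := eval_nil_iff.1 hμ
    obtain rfl := eval_nil_iff.1 hμ'
    simp [capRow, consRow]
  obtain ⟨z, hz⟩ := exists_zeroSplit hw hne h
  have hz1 := hz.one_le
  by_cases hzm : z ≤ m
  · obtain ⟨l, -, -, l3, -⟩ := exists_eval_catabolizable (hz.nodup_cat z)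
      (hz.labeling_cat le_rfl) hz1
    rw [hμ.unique (hz.eval_cat le_rfl hzm (Or.inr rfl) l3),
      hμ'.unique (hz.eval_cat le_rfl (by omega) (Or.inr rfl) l3)]
    simp [consRow]
  · have hm1 : m ≤ z := by omega
    have hm2 : m + 1 ≤ z := by omega
    have hmr : m < (firstRow (insertionTableau w)).length := by have := hz.le_length; omega
    obtain ⟨l, -, -, l3, -⟩ := exists_eval_catabolizable (hz.nodup_cat m) (hz.labeling_cat hm1) hm
    obtain ⟨lB, -, -, lB3, -⟩ := exists_eval_catabolizable (hz.nodup_cat (m + 1))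
      (hz.labeling_cat hm2) hm
    obtain ⟨l', -, -, l3', -⟩ := exists_eval_catabolizable (hz.nodup_cat (m + 1))
      (hz.labeling_cat hm2) (by omega : 1 ≤ m + 1)
    have hlen := hz.length_cat hm2
    -- `l` and `lB` are the results with cap `m` for the words with and without the extra letter of
    -- label `0`; `lB` and `l'` are the results with caps `m` and `m + 1` for the same word
    have hB := fun K =>
      ih _ (by omega) (hz.nodup_cat (m + 1)) (hz.labeling_cat hm2) hm lB3 l3' K rfl
    rw [hμ.unique (hz.eval_cat hm1 le_rfl (Or.inl rfl) l3),
      hμ'.unique (hz.eval_cat hm2 le_rfl (Or.inl rfl) l3')]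
    have ht := hz.take _ (List.mem_take_iff_getElem.2 ⟨m, by omega, rfl⟩)
    have hty : (firstRow (insertionTableau w))[m] ∉ rowWord (insertionTableau w).tail := by
      intro h'
      have := hz.below _ h'; omega
    rw [List.drop_eq_getElem_cons hmr, List.cons_append] at l3
    have l3 : Eval (capRow m) (queue (catLabel ℓ (rowWord (insertionTableau w).tail))
        (List.drop (m + 1) (firstRow (insertionTableau w)) ++ rowWord (insertionTableau w).tail) ++
          1 :: []) (consRow m (rows l)) := by
      rw [← List.singleton_append, queue_append] at l3
      simpa [queue, catLabel, hty, ht] using l3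
    obtain ⟨d, hd, hd'⟩ := l3.remove m _ [] 1 _ rfl le_rfl (capRow_antitone m)
      (fun i hi => by obtain rfl : i = 0 := (by omega); rfl) (fun b hb => one_le_of_mem_queue hb)
      (by simp) (by simp) (by simpa using lB3)
    rw [hd']
    cases K with
    | zero => simp
    | succ K =>
      have hK := hB K
      obtain ⟨d, rfl⟩ : ∃ e, d = e + 1 := ⟨d - 1, by omega⟩
      rw [inc_consRow]
      simp only [consRow] at hK ⊢
      rw [Finset.sum_range_succ', Finset.sum_range_succ']
      dsimp only
      have : ∑ i ∈ Finset.range K, inc (rows lB) d i ≤ ∑ i ∈ Finset.range K, rows lB i + 1 := by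
        have : ∀ i ∈ Finset.range K, inc (rows lB) d i = rows lB i + if d = i then 1 else 0 := by
          intro i _
          rw [inc_apply]
          split_ifs <;> omega
        rw [Finset.sum_congr rfl this, Finset.sum_add_distrib, Finset.sum_ite_eq]
        split_ifs <;> omega
      omega

theorem eval_cap_mono {w : List ℕ} {ℓ : ℕ → ℕ} (hw : w.Nodup) (h : IsLabeling w ℓ)
    {m j : ℕ} (hm : 1 ≤ m) (hmj : m ≤ j) {μ μ' : ℕ → ℕ} (hμ : Eval (capRow m) (queue ℓ w) μ)
    (hμ' : Eval (capRow j) (queue ℓ w) μ') (K : ℕ) :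
    ∑ i ∈ Finset.range K, μ (i + 1) ≤ ∑ i ∈ Finset.range K, μ' (i + 1) := by
  induction j, hmj using Nat.le_induction generalizing μ' with
  | base => rw [hμ.unique hμ']
  | succ j hmj ih =>
    obtain ⟨l, -, -, l3, -⟩ := exists_eval_catabolizable hw h (hm.trans hmj)
    exact (ih l3).trans (eval_cap_mono_succ hw h (hm.trans hmj) l3 hμ' K)

/-- A partition with parts at most `j` for which the insertion tableau is catabolizable is
dominated by the result of the algorithm with cap `j`. -/
theorem catabolizable_dominated {w : List ℕ} {ℓ : ℕ → ℕ} (hw : w.Nodup) (h : IsLabeling w ℓ)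
    {j : ℕ} {l : List ℕ} (hl : l.Pairwise (· ≥ ·)) (hlj : ∀ p ∈ l, 1 ≤ p ∧ p ≤ j)
    (hc : Catabolizable l (insertionTableau w)) {μ : ℕ → ℕ}
    (hμ : Eval (capRow j) (queue ℓ w) μ) (K : ℕ) :
    (l.take K).sum ≤ ∑ i ∈ Finset.range K, μ (i + 1) := by
  induction l generalizing w ℓ j μ K with
  | nil => simp
  | cons m l ih =>
    obtain ⟨c1, c2, c3⟩ := hc
    obtain ⟨l1, l2⟩ := List.pairwise_cons.1 hl
    obtain ⟨hm, hmj⟩ := hlj m (by simp)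
    have hne : w ≠ [] := by
      rintro rfl
      simp [insertionTableau, firstRow] at c1
      omega
    obtain ⟨z, hz⟩ := exists_zeroSplit hw hne h
    have hmz := hz.le_of_lt c1 c2
    obtain ⟨l', -, -, l3', -⟩ := exists_eval_catabolizable (hz.nodup_cat m) (hz.labeling_cat hmz) hm
    have key := eval_cap_mono hw h hm hmj (hz.eval_cat hmz le_rfl (Or.inl rfl) l3') hμ K
    refine le_trans ?_ key
    cases K with
    | zero => simp
    | succ K =>
      have := ih (hz.nodup_cat m) (hz.labeling_cat hmz) l2
        (fun p hp => ⟨(hlj p (by simp [hp])).1, l1 p hp⟩) c3 l3' K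
      rw [Finset.sum_range_succ']
      simp only [consRow] at this ⊢
      simp
      omega

theorem Catabolizable.sum_eq {w l : List ℕ} (hw : w.Nodup)
    (hc : Catabolizable l (insertionTableau w)) : l.sum = w.length := by
  induction l generalizing w with
  | nil =>
    have hp := (KnuthEq.perm (insertionTableau_spec hw).1).length_eq
    have hc : insertionTableau w = [] := hc
    rw [hp, hc]
    simp [rowWord]
  | cons m l ih =>
    obtain ⟨c1, c2, c3⟩ := hc
    have hp := KnuthEq.perm (insertionTableau_spec hw).1
    have e : rowWord (insertionTableau w) =
        rowWord (insertionTableau w).tail ++ firstRow (insertionTableau w) := by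
      cases insertionTableau w with
      | nil => rfl
      | cons r T => rw [rowWord_cons]; rfl
    rw [e] at hp
    have hnd :
        ((firstRow (insertionTableau w)).drop m ++ rowWord (insertionTableau w).tail).Nodup :=
      List.nodup_append_comm.1 ((hp.nodup_iff.1 hw).sublist
        ((List.Sublist.refl _).append (List.drop_sublist _ _)))
    have := ih hnd c3
    have := hp.length_eq
    simp at *
    omega

/-! ### Standard words and their labels -/

namespace StandardWord

theorem nodup (w : StandardWord) : w.1.Nodup := w.2.nodup_iff.2 List.nodup_range'

theorem mem_iff (w : StandardWord) {t : ℕ} : t ∈ w.1 ↔ 1 ≤ t ∧ t ≤ w.1.length := by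
  rw [w.2.mem_iff, List.mem_range'_1]; omega

theorem isLabeling (w : StandardWord) : IsLabeling w.1 (cochargeLabel w.1) := by
  refine ⟨fun t ht hm => ?_, fun s hs t ht hst hc => ?_⟩
  · have h1 := w.mem_iff.1 ht
    have := hm 1 (w.mem_iff.2 (by omega))
    obtain rfl : t = 1 := by omega
    rfl
  · have h1 := w.mem_iff.1 hs
    have h2 := w.mem_iff.1 ht
    have := hc (s + 1) (w.mem_iff.2 (by omega))
    obtain rfl : t = s + 1 := by omega
    obtain ⟨i, rfl⟩ : ∃ i, s = i + 1 := ⟨s - 1, by omega⟩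
    rfl

theorem eq_cochargeLabel (w : StandardWord) {ℓ : ℕ → ℕ} (h : IsLabeling w.1 ℓ) :
    ∀ t ∈ w.1, ℓ t = cochargeLabel w.1 t := by
  intro t
  induction t with
  | zero => intro ht; have := w.mem_iff.1 ht; omega
  | succ s ih =>
    intro ht
    have h1 := w.mem_iff.1 ht
    rcases Nat.eq_zero_or_pos s with rfl | hs
    · have hm : ∀ u ∈ w.1, 0 + 1 ≤ u := fun u hu => (w.mem_iff.1 hu).1
      rw [h.zero _ ht hm, w.isLabeling.zero _ ht hm]
    · have hs' : s ∈ w.1 := w.mem_iff.2 (by omega)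
      rw [h.succ s hs' _ ht (by omega) fun r _ => by omega,
        w.isLabeling.succ s hs' _ ht (by omega) fun r _ => by omega, ih hs']

/-- The queue of a standard word: its cocharge labels, increased by one, from right to left. -/
def labelQueue (w : StandardWord) : List ℕ := queue (cochargeLabel w.1) w.1

theorem labelQueue_eq (w : StandardWord) {ℓ : ℕ → ℕ} (h : IsLabeling w.1 ℓ) :
    w.labelQueue = queue ℓ w.1 :=
  queue_congr fun t ht => (w.eq_cochargeLabel h t ht).symm

theorem length_labelQueue (w : StandardWord) : w.labelQueue.length = w.1.length := by
  simp [labelQueue, queue]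

theorem lt_iff (w : StandardWord) {i k : ℕ} (hi : i < w.1.length) (hk : k < w.1.length) :
    w.1[i] < w.1[k] ↔ cochargeLabel w.1 w.1[i] < cochargeLabel w.1 w.1[k] ∨
      cochargeLabel w.1 w.1[i] = cochargeLabel w.1 w.1[k] ∧ i < k := by
  have key : ∀ {i k : ℕ} (hi : i < w.1.length) (hk : k < w.1.length), w.1[i] < w.1[k] →
      cochargeLabel w.1 w.1[i] < cochargeLabel w.1 w.1[k] ∨
        cochargeLabel w.1 w.1[i] = cochargeLabel w.1 w.1[k] ∧ i < k := by
    intro i k hi hk h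
    obtain ⟨h1, h2⟩ := w.isLabeling.mono (List.getElem_mem hi) (List.getElem_mem hk) h
    rw [w.nodup.idxOf_getElem, w.nodup.idxOf_getElem] at h2
    rcases h1.lt_or_eq with h1 | h1
    · exact Or.inl h1
    · exact Or.inr ⟨h1, h2 h1⟩
  refine ⟨key hi hk, fun h => ?_⟩
  by_contra hlt
  rcases (not_lt.1 hlt).lt_or_eq with h' | h'
  · have := key hk hi h'
    omega
  · have : k = i := (w.nodup.getElem_inj_iff).1 h'
    subst this
    omega

/-- A standard word is the standardization of its labeling, hence determined by it. -/
theorem labelQueue_injective : Function.Injective labelQueue := by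
  intro u v huv
  have hlen : u.1.length = v.1.length := by
    rw [← length_labelQueue, ← length_labelQueue, huv]
  have hlab : ∀ (i : ℕ) (hi : i < u.1.length) (hi' : i < v.1.length),
      cochargeLabel u.1 u.1[i] = cochargeLabel v.1 v.1[i] := by
    intro i hi hi'
    have h := List.reverse_injective huv
    have := List.getElem_of_eq h (i := i) (by simpa using hi)
    simpa using this
  have hord : ∀ (i k : ℕ) (hi : i < u.1.length) (hk : k < u.1.length),
      v.1[i] < v.1[k] → u.1[i] < u.1[k] := by
    intro i k hi hk h
    rw [v.lt_iff] at h
    rw [u.lt_iff, hlab i hi (by omega), hlab k hk (by omega)]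
    exact h
  -- the entries agree by induction on their size, since both words have the same relative order
  have main : ∀ (a i : ℕ) (hi : i < u.1.length), u.1[i] = a → v.1[i] = a := by
    intro a
    induction a using Nat.strong_induction_on with
    | _ a ih =>
    intro i hi ha
    have hmem := u.mem_iff.1 (ha ▸ List.getElem_mem hi)
    rcases lt_trichotomy v.1[i] a with h | h | h
    · obtain ⟨k, hk, hk'⟩ := List.getElem_of_mem ((u.mem_iff (t := v.1[i])).2 (by
        have := v.mem_iff.1 (List.getElem_mem (hlen ▸ hi)); omega))
      have h1 := ih _ h k hk hk'
      obtain rfl : k = i := v.nodup.getElem_inj_iff.1 h1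
      omega
    · exact h
    · obtain ⟨k, hk, hk'⟩ := List.getElem_of_mem ((v.mem_iff (t := a)).2 (by omega))
      have h1 := hord k i (by omega) hi (by omega)
      have h2 := ih _ (by omega) k (by omega) rfl
      omega
  exact Subtype.ext (List.ext_getElem hlen fun i hi _ => (main _ i hi rfl).symm)

end StandardWord

theorem IsLabeling.lt_of_lt {w : List ℕ} {ℓ : ℕ → ℕ} (h : IsLabeling w ℓ) {s t : ℕ} (hs : s ∈ w)
    (ht : t ∈ w) (hst : ℓ s < ℓ t) : s < t := by
  by_contra hlt
  rcases (not_lt.1 hlt).lt_or_eq with h' | rfl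
  · have := (h.mono ht hs h').1; omega
  · omega

theorem IsLabeling.lt_of_eq {p s : List ℕ} {a b : ℕ} {ℓ : ℕ → ℕ}
    (h : IsLabeling (p ++ a :: s) ℓ) (hnd : (p ++ a :: s).Nodup) (hb : b ∈ s)
    (hab : ℓ a = ℓ b) : a < b := by
  have hidx := idxOf_lt_idxOf_of_nodup hnd hb
  by_contra hlt
  rcases (not_lt.1 hlt).lt_or_eq with h' | rfl
  · have := (h.mono (s := b) (t := a) (by simp [hb]) (by simp) h').2 hab.symm; omega
  · omega

/-- A non-zero corotation increases the label of the moved letter by one and keeps the others. -/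
theorem IsLabeling.corotation {y : List ℕ} {a : ℕ} {ℓ : ℕ → ℕ} (hnd : (y ++ [a]).Nodup)
    (h : IsLabeling (y ++ [a]) ℓ) (ha : 0 < ℓ a) :
    IsLabeling (a :: y) (Function.update ℓ a (ℓ a + 1)) := by
  have hay : a ∉ y := fun h' => (List.nodup_append.1 hnd).2.2 a h' a (by simp) rfl
  have hmem : ∀ t, t ∈ a :: y ↔ t ∈ y ++ [a] := by intro t; simp; tauto
  have i1 : ∀ t ∈ y, (y ++ [a]).idxOf t = y.idxOf t := fun t ht => List.idxOf_append_of_mem ht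
  have i2 : (y ++ [a]).idxOf a = y.length := by
    rw [List.idxOf_append_of_notMem hay]; simp
  have i3 : ∀ t ∈ y, (a :: y).idxOf t = y.idxOf t + 1 := fun t ht =>
    List.idxOf_cons_ne _ (by rintro rfl; exact hay ht)
  have i4 : ∀ t ∈ y, y.idxOf t < y.length := fun t ht => List.idxOf_lt_length_iff.2 ht
  refine ⟨fun t ht hm => ?_, fun s hs t ht hst hc => ?_⟩
  · have h0 := h.zero t ((hmem t).1 ht) fun s hs => hm s ((hmem s).2 hs)
    rw [Function.update_of_ne, h0]
    rintro rfl
    omega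
  · have h1 := h.succ s ((hmem s).1 hs) t ((hmem t).1 ht) hst fun r hr => hc r ((hmem r).2 hr)
    have hne : ∀ t ∈ y, t ≠ a := fun t ht e => hay (e ▸ ht)
    rcases List.mem_cons.1 hs with rfl | hs' <;> rcases List.mem_cons.1 ht with rfl | ht'
    · omega
    · rw [i1 t ht', i2, if_pos (i4 t ht')] at h1
      rw [Function.update_self, Function.update_of_ne (hne t ht'), h1]
      simp
    · rw [i1 s hs', i2, if_neg (by have := i4 s hs'; omega)] at h1
      rw [Function.update_self, Function.update_of_ne (hne s hs'), h1, i3 s hs']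
      simp
    · rw [Function.update_of_ne (hne t ht'), Function.update_of_ne (hne s hs'), h1, i1 s hs',
        i1 t ht', i3 s hs', i3 t ht']
      simp

theorem labelQueue_of_corotation {u v : StandardWord} {y : List ℕ} {a : ℕ} (hu : u.1 = y ++ [a])
    (hv : v.1 = a :: y) (ha : 0 < cochargeLabel u.1 a) :
    ∃ q, u.labelQueue = (cochargeLabel u.1 a + 1) :: q ∧
      v.labelQueue = q ++ [cochargeLabel u.1 a + 1 + 1] := by
  have h := u.isLabeling
  have hnd := u.nodup
  generalize hℓ : cochargeLabel u.1 = ℓ at h ha ⊢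
  rw [hu] at h hnd
  have hay : a ∉ y := fun h' => (List.nodup_append.1 hnd).2.2 a h' a (by simp) rfl
  have h' := h.corotation hnd ha
  rw [← hv] at h'
  refine ⟨queue ℓ y, ?_, ?_⟩
  · rw [StandardWord.labelQueue, hℓ, hu, queue_append]; rfl
  · rw [v.labelQueue_eq h', hv, ← List.singleton_append, queue_append,
      queue_congr (w := y) (ℓ' := ℓ)]
    · simp [queue]
    · intro t ht
      rw [Function.update_of_ne]
      rintro rfl; exact hay ht

/-! ### Lifting moves of queues to standard words -/

/-- The order of the letters in the moved block is determined by their labels and positions, which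
identifies the move as a catabolism or Knuth transformation. -/
theorem exists_lift_of_move {F : StandardWord → YoungDiagram} (hF : IsNormalizedInvariant F)
    {u : StandardWord} {q : List ℕ} (h : QueueStep u.labelQueue q) :
    ∃ v : StandardWord, v.labelQueue = q ∧ F v = F u := by
  have hl := u.isLabeling
  have hnd := u.nodup
  have lift : ∀ v : List ℕ, u.1.Perm v → IsLabeling v (cochargeLabel u.1) →
      queue (cochargeLabel u.1) v = q →
      (CatabolismTransformation u.1 v ∨ KnuthTransformation u.1 v) →
      ∃ v : StandardWord, v.labelQueue = q ∧ F v = F u := by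
    intro v hp hlv hq ht
    refine ⟨⟨v, hp.symm.trans (hp.length_eq ▸ u.2)⟩, ?_, ?_⟩
    · rw [← hq]; exact StandardWord.labelQueue_eq ⟨v, _⟩ hlv
    · rcases ht with ht | ht
      · exact (hF.catabolism u ⟨v, _⟩ ht).symm
      · exact (hF.knuth u ⟨v, _⟩ ht).symm
  have liftK : ∀ v : List ℕ, queue (cochargeLabel u.1) v = q → KnuthTransformation u.1 v →
      ∃ v : StandardWord, v.labelQueue = q ∧ F v = F u := fun v hq ht =>
    lift v ht.perm (hl.knuth hnd ht).1 hq (Or.inr ht)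
  have liftC : ∀ (x y : List ℕ) (a b : ℕ), u.1 = x ++ [a, b] ++ y →
      queue (cochargeLabel u.1) (x ++ [b, a] ++ y) = q →
      1 < |(cochargeLabel u.1 a : ℤ) - (cochargeLabel u.1 b : ℤ)| →
      ∃ v : StandardWord, v.labelQueue = q ∧ F v = F u := by
    intro x y a b hu hq hab
    refine lift _ ?_ ?_ hq (Or.inl ⟨x, y, a, b, hu, rfl, hab⟩)
    · rw [hu]
      exact ((List.Perm.refl x).append (List.Perm.swap b a [])).append (List.Perm.refl y)
    · have hex := hl.exists_between (p := a) (q := b) (by rw [hu]; simp) (by rw [hu]; simp) hab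
      generalize cochargeLabel u.1 = ℓ at *
      rw [hu] at hl hex
      exact hl.swap hex
  generalize hℓ : cochargeLabel u.1 = ℓ at *
  obtain ⟨X, Y, U, V, h1, rfl, h3⟩ := h
  rw [StandardWord.labelQueue, hℓ, queue, List.reverse_eq_iff] at h1
  simp only [List.reverse_append] at h1
  rw [← List.append_assoc] at h1
  obtain ⟨ym, x, hu, hym, hx⟩ := List.map_eq_append_iff.1 h1
  obtain ⟨y, m, rfl, hy, hm⟩ := List.map_eq_append_iff.1 hym
  have hX : queue ℓ x = X := by rw [queue, hx, List.reverse_reverse]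
  have hY : queue ℓ y = Y := by rw [queue, hy, List.reverse_reverse]
  have hq : ∀ m', queue ℓ m' = V → queue ℓ (y ++ m' ++ x) = X ++ V ++ Y := fun m' hm' => by
    rw [queue_append, queue_append, hX, hY, hm', List.append_assoc]
  rw [hu] at hl hnd
  rcases h3 with h3 | h3 <;> cases h3 with
  | far a b hab =>
    obtain ⟨p, q, rfl⟩ : ∃ p q, m = [p, q] := List.length_eq_two.1 (by
      rw [← List.length_map, hm]; rfl)
    simp at hm
    refine liftC y x p q hu (hq _ (by simp [queue, hm])) ?_
    rw [lt_abs]; omega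
  | upper a =>
    obtain ⟨p, q, s, rfl⟩ : ∃ p q s, m = [p, q, s] := List.length_eq_three.1 (by
      rw [← List.length_map, hm]; rfl)
    simp at hm
    obtain ⟨hm1, hm2, hm3⟩ := hm
    first
    | have hqp : q < p := hl.lt_of_lt (by simp) (by simp) (by omega)
      have hps : p < s := by
        have e : y ++ [p, q, s] ++ x = y ++ p :: (q :: s :: x) := by simp
        rw [e] at hl hnd
        exact hl.lt_of_eq hnd (by simp) (by omega)
      exact liftK (y ++ [p, s, q] ++ x) (hq _ (by simp [queue, hm1, hm2, hm3]))
        ⟨y, x, q, p, s, hqp, hps, Or.inl ⟨hu, rfl⟩⟩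
    | have hsp : s < p := hl.lt_of_lt (by simp) (by simp) (by omega)
      have hpq : p < q := by
        have e : y ++ [p, q, s] ++ x = y ++ p :: (q :: s :: x) := by simp
        rw [e] at hl hnd
        exact hl.lt_of_eq hnd (by simp) (by omega)
      exact liftK (y ++ [p, s, q] ++ x) (hq _ (by simp [queue, hm1, hm2, hm3]))
        ⟨y, x, s, p, q, hsp, hpq, Or.inr (Or.inl ⟨hu, rfl⟩)⟩
  | lower a =>
    obtain ⟨p, q, s, rfl⟩ : ∃ p q s, m = [p, q, s] := List.length_eq_three.1 (by
      rw [← List.length_map, hm]; rfl)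
    simp at hm
    obtain ⟨hm1, hm2, hm3⟩ := hm
    first
    | have hsq : s < q := hl.lt_of_lt (by simp) (by simp) (by omega)
      have hps : p < s := by
        have e : y ++ [p, q, s] ++ x = y ++ p :: (q :: s :: x) := by simp
        rw [e] at hl hnd
        exact hl.lt_of_eq hnd (by simp) (by omega)
      exact liftK (y ++ [q, p, s] ++ x) (hq _ (by simp [queue, hm1, hm2, hm3]))
        ⟨y, x, p, s, q, hps, hsq, Or.inr (Or.inr (Or.inl ⟨hu, rfl⟩))⟩
    | have hsp : s < p := hl.lt_of_lt (by simp) (by simp) (by omega)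
      have hqs : q < s := by
        have e : y ++ [p, q, s] ++ x = (y ++ [p]) ++ q :: (s :: x) := by simp
        rw [e] at hl hnd
        exact hl.lt_of_eq hnd (by simp) (by omega)
      exact liftK (y ++ [q, p, s] ++ x) (hq _ (by simp [queue, hm1, hm2, hm3]))
        ⟨y, x, q, s, p, hqs, hsp, Or.inr (Or.inr (Or.inr ⟨hu, rfl⟩))⟩

/-- Equivalence of queues under moves. -/
abbrev QueueEquiv : List ℕ → List ℕ → Prop := Relation.ReflTransGen QueueStep

theorem QueueEquiv.append {p q : List ℕ} (h : QueueEquiv p q) (s t : List ℕ) :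
    QueueEquiv (s ++ p ++ t) (s ++ q ++ t) := by
  induction h with
  | refl => exact Relation.ReflTransGen.refl
  | tail _ h ih =>
    obtain ⟨x, y, u, v, rfl, rfl, h⟩ := h
    exact ih.tail ⟨s ++ x, y ++ t, u, v, by simp, by simp, h⟩

theorem QueueEquiv.symm {p q : List ℕ} (h : QueueEquiv p q) : QueueEquiv q p := by
  induction h with
  | refl => exact Relation.ReflTransGen.refl
  | tail _ h ih => exact ih.head h.symm

theorem QueueMove.equiv {u v : List ℕ} (h : QueueMove u v ∨ QueueMove v u) : QueueEquiv u v :=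
  Relation.ReflTransGen.single ⟨[], [], u, v, by simp, by simp, h⟩

theorem QueueMove.length_eq {u v : List ℕ} (h : QueueMove u v) : u.length = v.length := by
  cases h <;> rfl

theorem QueueEquiv.length_eq {p q : List ℕ} (h : QueueEquiv p q) : p.length = q.length := by
  induction h with
  | refl => rfl
  | tail _ h ih =>
    obtain ⟨x, y, u, v, rfl, rfl, h | h⟩ := h <;> simpa [h.length_eq] using ih

theorem exists_lift {F : StandardWord → YoungDiagram} (hF : IsNormalizedInvariant F)
    {u : StandardWord} {q : List ℕ} (h : QueueEquiv u.labelQueue q) :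
    ∃ v : StandardWord, v.labelQueue = q ∧ F v = F u := by
  induction h with
  | refl => exact ⟨u, rfl, rfl⟩
  | tail _ h ih =>
    obtain ⟨v, rfl, hv⟩ := ih
    obtain ⟨v', hv', e⟩ := exists_lift_of_move hF h
    exact ⟨v', hv', e.trans hv⟩

theorem exists_lift_corotation {F : StandardWord → YoungDiagram} (hF : IsNormalizedInvariant F)
    {u : StandardWord} {q : List ℕ} {c : ℕ} (h : u.labelQueue = c :: q) (hc : 2 ≤ c) :
    ∃ v : StandardWord, v.labelQueue = q ++ [c + 1] ∧ F v = F u := by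
  rcases List.eq_nil_or_concat' u.1 with hu | ⟨y, a, hu⟩
  · rw [StandardWord.labelQueue, hu] at h; simp [queue] at h
  have hac : cochargeLabel u.1 a + 1 = c := by
    have h' := h
    rw [StandardWord.labelQueue] at h'
    generalize cochargeLabel u.1 = ℓ at *
    rw [hu, queue_append] at h'
    simp [queue] at h'
    exact h'.1
  have ha : 0 < cochargeLabel u.1 a := by omega
  have hp : u.1.Perm (a :: y) := by rw [hu]; exact List.perm_append_singleton a y
  let v : StandardWord := ⟨a :: y, hp.symm.trans (hp.length_eq ▸ u.2)⟩
  obtain ⟨q', h1, h2⟩ := labelQueue_of_corotation (v := v) hu rfl ha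
  rw [hac] at h1 h2
  rw [h] at h1
  obtain rfl : q = q' := by simpa using h1
  refine ⟨v, h2, (hF.corotation u v ⟨y, a, ?_, hu, rfl, ha⟩).symm⟩
  rintro rfl
  simp [cochargeLabel] at ha

/-! ### The steps of the algorithm as equivalences of queues -/

/-- The queue `1 ⋯ 1 2 ⋯ 2 ⋯ K ⋯ K` in which `i` occurs `ν i` times, for `1 ≤ i ≤ K`. -/
def rowsQueue : ℕ → (ℕ → ℕ) → List ℕ
  | 0, _ => []
  | K + 1, ν => rowsQueue K ν ++ List.replicate (ν (K + 1)) (K + 1)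

theorem rowsQueue_congr {K : ℕ} {ν ν' : ℕ → ℕ} (h : ∀ i ≤ K, ν i = ν' i) :
    rowsQueue K ν = rowsQueue K ν' := by
  induction K with
  | zero => rfl
  | succ K ih => rw [rowsQueue, rowsQueue, ih fun i hi => h i (by omega), h _ le_rfl]

theorem rowsQueue_of_le {K K' : ℕ} {ν : ℕ → ℕ} (hK : K ≤ K') (h : ∀ i > K, ν i = 0) :
    rowsQueue K' ν = rowsQueue K ν := by
  induction K', hK using Nat.le_induction with
  | base => rfl
  | succ K' hK ih => rw [rowsQueue, ih, h _ (by omega)]; simp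

theorem le_of_mem_rowsQueue {K : ℕ} {ν : ℕ → ℕ} {c : ℕ} (h : c ∈ rowsQueue K ν) : c ≤ K := by
  induction K with
  | zero => simp [rowsQueue] at h
  | succ K ih =>
    rcases List.mem_append.1 h with h | h
    · exact (ih h).trans (by omega)
    · exact (List.eq_of_mem_replicate h).le

theorem le_length_rowsQueue {K : ℕ} {ν : ℕ → ℕ} (hK : 1 ≤ K) : ν 1 ≤ (rowsQueue K ν).length := by
  induction K, hK using Nat.le_induction with
  | base => simp [rowsQueue]
  | succ K hK ih => rw [rowsQueue]; simp; omega

theorem queueEquiv_far {c : ℕ} {l : List ℕ} (h : ∀ b ∈ l, b + 2 ≤ c ∨ c + 2 ≤ b) :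
    QueueEquiv (l ++ [c]) (c :: l) := by
  induction l with
  | nil => exact Relation.ReflTransGen.refl
  | cons b l ih =>
    have h1 := (ih fun d hd => h d (by simp [hd])).append [b] []
    have h2 : QueueEquiv [b, c] [c, b] := QueueMove.equiv (by
      rcases h b (by simp) with h | h
      · exact Or.inl (QueueMove.far b c h)
      · exact Or.inr (QueueMove.far c b h))
    have h2 := h2.append [] l
    simp only [List.nil_append, List.append_nil, List.cons_append] at h1 h2 ⊢
    exact h1.trans h2

/-- The word `a^p (a + 1)^p` commutes with `a` and `a + 1` up to moves. -/
theorem queueEquiv_central (a p : ℕ) {x : ℕ} (hx : x = a ∨ x = a + 1) :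
    QueueEquiv (List.replicate p a ++ List.replicate p (a + 1) ++ [x])
      (x :: (List.replicate p a ++ List.replicate p (a + 1))) := by
  induction p generalizing x with
  | zero => exact Relation.ReflTransGen.refl
  | succ p ih =>
    have e : List.replicate (p + 1) a ++ List.replicate (p + 1) (a + 1) =
        a :: ((List.replicate p a ++ List.replicate p (a + 1)) ++ [a + 1]) := by
      rw [List.replicate_succ' (n := p) (a := a + 1)]; simp [List.replicate_succ]
    have ih' : ∀ x, x = a ∨ x = a + 1 → _ := fun x hx => ih (x := x) hx
    rw [e]
    generalize List.replicate p a ++ List.replicate p (a + 1) = W at ih'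
    have hb := ih' (a + 1) (Or.inr rfl)
    -- `a W (a + 1) ~ a (a + 1) W`, and both `a (a + 1)` and `W` commute with `x`
    have h1 := hb.append [a] [x]
    have h2 := (ih' x hx).append [a, a + 1] []
    have h3 : QueueEquiv [a, a + 1, x] [x, a, a + 1] := by
      rcases hx with rfl | rfl
      · exact QueueMove.equiv (Or.inl (QueueMove.lower x))
      · exact QueueMove.equiv (Or.inr (QueueMove.upper a))
    have h3 := h3.append [] W
    have hb' : QueueEquiv ((a + 1) :: W) (W ++ [a + 1]) := QueueEquiv.symm hb
    have h4 := hb'.append [x, a] []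
    simp only [List.nil_append, List.append_nil, List.cons_append, List.append_assoc]
      at h1 h2 h3 h4 ⊢
    exact ((h1.trans h2).trans h3).trans h4

/-- With `p = ν (c + 1) ≤ ν c`, the new `c` passes the factor `c^p (c + 1)^p`. -/
theorem rowsQueue_insert {K c : ℕ} {ν : ℕ → ℕ} (hν : Antitone ν) (hc : 1 ≤ c) (hcK : c ≤ K) :
    QueueEquiv (rowsQueue K ν ++ [c]) (rowsQueue K (inc ν c)) := by
  induction K with
  | zero => omega
  | succ K ih =>
    rcases Nat.lt_or_ge K c with h | h
    · obtain rfl : c = K + 1 := by omega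
      rw [rowsQueue, rowsQueue, inc_self,
        rowsQueue_congr (ν' := ν) fun i hi => inc_of_ne ν (by omega), List.replicate_succ']
      rw [List.append_assoc]
    · rcases h.lt_or_eq with h' | rfl
      · have h1 : QueueEquiv (List.replicate (ν (K + 1)) (K + 1) ++ [c])
            (c :: List.replicate (ν (K + 1)) (K + 1)) := queueEquiv_far fun b hb => by
          have := List.eq_of_mem_replicate hb; omega
        have h1 := h1.append (rowsQueue K ν) []
        have h2 := (ih h).append [] (List.replicate (ν (K + 1)) (K + 1))
        rw [rowsQueue, rowsQueue, inc_of_ne ν (by omega)]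
        simp only [List.nil_append, List.append_nil, List.cons_append, List.append_assoc]
          at h1 h2 ⊢
        exact h1.trans h2
      · obtain ⟨k, rfl⟩ : ∃ k, c = k + 1 := ⟨c - 1, by omega⟩
        obtain ⟨d, hd⟩ := Nat.exists_eq_add_of_le (hν (Nat.le_succ (k + 1)))
        have h1 := (queueEquiv_central (k + 1) (ν (k + 1 + 1)) (Or.inl rfl)).append
          (rowsQueue k ν ++ List.replicate d (k + 1)) []
        rw [rowsQueue, rowsQueue, rowsQueue, rowsQueue, inc_self, inc_of_ne ν (by omega),
          rowsQueue_congr (ν' := ν) fun i hi => inc_of_ne ν (by omega), hd]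
        rw [show ν (k + 1).succ + d + 1 = d + 1 + ν (k + 1 + 1) by rw [Nat.succ_eq_add_one]; omega,
          show ν (k + 1).succ + d = d + ν (k + 1 + 1) from Nat.add_comm _ _,
          ← List.replicate_append_replicate (n := d + 1), List.replicate_succ',
          ← List.replicate_append_replicate (n := d)]
        simp only [List.append_nil, List.nil_append, List.cons_append, List.append_assoc] at h1 ⊢
        exact h1

/-- With `p = ν c = ν (c - 1)`, the new `c` passes the factor `(c - 1)^p c^p` to the front. -/
theorem rowsQueue_rotate {K c : ℕ} {ν : ℕ → ℕ} (hc : 2 ≤ c) (hcK : c ≤ K)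
    (h : ν c = ν (c - 1)) : QueueEquiv (rowsQueue K (inc ν c)) (c :: rowsQueue K ν) := by
  induction K with
  | zero => omega
  | succ K ih =>
    rcases Nat.lt_or_ge K c with h' | h'
    · obtain rfl : c = K + 1 := by omega
      obtain ⟨k, rfl⟩ : ∃ k, K = k + 1 := ⟨K - 1, by omega⟩
      rw [Nat.add_sub_cancel] at h
      rw [rowsQueue, rowsQueue, rowsQueue, rowsQueue, inc_self, inc_of_ne ν (by omega),
        rowsQueue_congr (ν' := ν) fun i hi => inc_of_ne ν (by omega), h, List.replicate_succ']
      have h1 := (queueEquiv_central (k + 1) (ν (k + 1)) (Or.inr rfl)).append (rowsQueue k ν) []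
      have h2 : QueueEquiv (rowsQueue k ν ++ [k + 1 + 1]) ((k + 1 + 1) :: rowsQueue k ν) :=
        queueEquiv_far fun b hb => by have := le_of_mem_rowsQueue hb; omega
      have h2 := h2.append [] (List.replicate (ν (k + 1)) (k + 1) ++
        List.replicate (ν (k + 1)) (k + 1 + 1))
      simp only [List.nil_append, List.append_nil, List.cons_append, List.append_assoc]
        at h1 h2 ⊢
      exact h1.trans h2
    · rw [rowsQueue, rowsQueue, inc_of_ne ν (by omega)]
      simpa using (ih h').append [] (List.replicate (ν (K + 1)) (K + 1))

/-- A run of the algorithm, read as a sequence of transformations of standard words under which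
every invariant `F` is constant. -/
theorem exists_rowsQueue {F : StandardWord → YoungDiagram} (hF : IsNormalizedInvariant F)
    {ν ν' : ℕ → ℕ} {q : List ℕ} (h : Eval ν q ν') :
    ∀ (w : StandardWord) (K : ℕ), Antitone ν → ν 0 = w.1.length + 1 → (∀ i > K, ν i = 0) →
      w.labelQueue = rowsQueue K ν ++ q →
      ∃ (w' : StandardWord) (K' : ℕ), F w' = F w ∧ (∀ i > K', ν' i = 0) ∧
        w'.labelQueue = rowsQueue K' ν' := by
  induction h using Eval.rec_on with
  | nil ν => exact fun w K _ _ hK hw => ⟨w, K, rfl, hK, by simpa using hw⟩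
  | insert ν c q ν' hc h ih =>
    intro w K hν h0 hK hw
    have hc1 : 1 ≤ c := by
      have : c ∈ w.labelQueue := by rw [hw]; simp
      exact one_le_of_mem_queue this
    have hK' : ∀ i > max K c, ν i = 0 := fun i hi => hK i (by omega)
    rw [← rowsQueue_of_le (le_max_left K c) hK] at hw
    have h1 := (rowsQueue_insert hν hc1 (le_max_right K c)).append [] q
    obtain ⟨v, hv, hFv⟩ := exists_lift hF (u := w) (q := rowsQueue (max K c) (inc ν c) ++ q)
      (by rw [hw]; simpa using h1)
    have hlen : v.1.length = w.1.length := by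
      rw [← v.length_labelQueue, ← w.length_labelQueue, hv, hw]
      simpa using h1.length_eq.symm
    obtain ⟨w', K', hF', h'⟩ := ih v (max K c) (inc_antitone hν hc)
      (by rw [inc_of_ne ν (by omega), h0, hlen])
      (fun i hi => by rw [inc_of_ne ν (by omega), hK' i hi]) hv
    exact ⟨w', K', hF'.trans hFv, h'⟩
  | rotate ν c q ν' hc h ih =>
    intro w K hν h0 hK hw
    have hc1 : 1 ≤ c := by
      have : c ∈ w.labelQueue := by rw [hw]; simp
      exact one_le_of_mem_queue this
    have hK' : ∀ i > max K c, ν i = 0 := fun i hi => hK i (by omega)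
    rw [← rowsQueue_of_le (le_max_left K c) hK] at hw
    have hlen := congrArg List.length hw
    rw [w.length_labelQueue, List.length_append] at hlen
    have hc2 : 2 ≤ c := by
      -- row `0` is longer than the word, so row `1` is never full
      by_contra hc2
      obtain rfl : c = 1 := by omega
      have := le_length_rowsQueue (ν := ν) (le_max_right K 1)
      simp at hc
      omega
    have hνc : ν c = ν (c - 1) := le_antisymm (hν (Nat.sub_le c 1)) (not_lt.1 hc)
    have h1 := (rowsQueue_insert hν hc1 (le_max_right K c)).trans
      (rowsQueue_rotate hc2 (le_max_right K c) hνc)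
    have h1 := QueueEquiv.append h1 [] q
    obtain ⟨v, hv, hFv⟩ := exists_lift hF (u := w) (q := c :: (rowsQueue (max K c) ν ++ q))
      (by rw [hw]; simpa using h1)
    obtain ⟨v', hv', hFv'⟩ := exists_lift_corotation hF hv hc2
    have hlen' : v'.1.length = w.1.length := by
      rw [← v'.length_labelQueue, hv', hlen]
      simp
    obtain ⟨w', K', hF', h'⟩ := ih v' (max K c) hν (by rw [h0, hlen']) hK' (by simpa using hv')
    exact ⟨w', K', (hF'.trans hFv').trans hFv, h'⟩

/-- The queue of `rowword(Z*_λ)`, for `λ` given by the list of its parts. -/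
def shapeQueue : List ℕ → List ℕ
  | [] => []
  | m :: l => List.replicate m 1 ++ (shapeQueue l).map (· + 1)

theorem one_le_of_mem_shapeQueue {l : List ℕ} {c : ℕ} (h : c ∈ shapeQueue l) : 1 ≤ c := by
  cases l with
  | nil => simp [shapeQueue] at h
  | cons m l =>
    rcases List.mem_append.1 h with h | h
    · exact (List.eq_of_mem_replicate h).ge
    · obtain ⟨d, -, rfl⟩ := List.mem_map.1 h
      omega

theorem rowsQueue_consRow (K j : ℕ) (ν : ℕ → ℕ) :
    rowsQueue (K + 1) (consRow j ν) =
      List.replicate (ν 0) 1 ++ (rowsQueue K ν).map (· + 1) := by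
  induction K with
  | zero => simp [rowsQueue, consRow]
  | succ K ih => rw [rowsQueue, ih, rowsQueue]; simp [consRow]

theorem rowsQueue_rows {l : List ℕ} (hl : ∀ p ∈ l, 0 < p) (j K : ℕ)
    (hK : ∀ i > K, consRow j (rows l) i = 0) : rowsQueue K (consRow j (rows l)) = shapeQueue l := by
  induction l generalizing j K with
  | nil =>
    rw [rowsQueue_of_le (Nat.zero_le K)]
    · rfl
    · intro i hi
      obtain ⟨i, rfl⟩ : ∃ k, i = k + 1 := ⟨i - 1, by omega⟩
      simp [consRow, rows]
  | cons m l ih =>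
    cases K with
    | zero =>
      have h1 := hK 1 (by omega)
      have h2 := hl m (by simp)
      simp [consRow, rows] at h1
      omega
    | succ K =>
      rw [rowsQueue_consRow, rows_cons, shapeQueue,
        ih (fun p hp => hl p (by simp [hp])) m K fun i hi => ?_]
      · rfl
      · have := hK (i + 1) (by omega)
        rwa [rows_cons] at this

theorem eval_shapeQueue {l : List ℕ} (hl : l.Pairwise (· ≥ ·)) {j : ℕ} (hlj : ∀ p ∈ l, p ≤ j) :
    Eval (capRow j) (shapeQueue l) (consRow j (rows l)) := by
  induction l generalizing j with
  | nil => rw [rows_nil]; exact Eval.nil _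
  | cons m l ih =>
    obtain ⟨l1, l2⟩ := List.pairwise_cons.1 hl
    rw [capRow_eq, shapeQueue, rows_cons]
    refine Eval.insert_replicate (by simpa using hlj m (by simp)) ?_
    rw [Nat.zero_add]
    exact (ih l2 l1).shift j fun c hc => one_le_of_mem_shapeQueue hc

theorem mem_rowWord_fillRows {s t : ℕ} {l : List ℕ} :
    t ∈ rowWord (fillRows s l) ↔ s < t ∧ t ≤ s + l.sum := by
  have h : (rowWord (fillRows s l)).Perm (List.range' (s + 1) l.sum) := by
    rw [← flatten_fillRows]
    exact (List.reverse_perm (fillRows s l)).flatten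
  rw [h.mem_iff, List.mem_range'_1]
  omega

theorem exists_labeling_fillRows {l : List ℕ} (hl : ∀ p ∈ l, 0 < p) (s : ℕ) :
    ∃ ℓ, IsLabeling (rowWord (fillRows s l)) ℓ ∧
      queue ℓ (rowWord (fillRows s l)) = shapeQueue l := by
  induction l generalizing s with
  | nil => exact ⟨fun _ => 0, ⟨by simp [fillRows, rowWord], by simp [fillRows, rowWord]⟩, rfl⟩
  | cons m l ih =>
    obtain ⟨ℓ, h, hq⟩ := ih (fun p hp => hl p (by simp [hp])) (s + m)
    have hm : 0 < m := hl m (by simp)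
    have hmem : ∀ t, t ∈ rowWord (fillRows (s + m) l) ↔ s + m < t ∧ t ≤ s + m + l.sum := fun t =>
      mem_rowWord_fillRows
    rw [fillRows, rowWord_cons]
    generalize rowWord (fillRows (s + m) l) = v at *
    have hr : ∀ t, t ∈ List.range' (s + 1) m ↔ s < t ∧ t ≤ s + m := fun t => by
      rw [List.mem_range'_1]; omega
    have i1 : ∀ t ∈ v, (v ++ List.range' (s + 1) m).idxOf t = v.idxOf t := fun t ht =>
      List.idxOf_append_of_mem ht
    have i2 : ∀ t ∈ List.range' (s + 1) m,
        (v ++ List.range' (s + 1) m).idxOf t = v.length + (t - (s + 1)) := fun t ht => by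
      have h1 := (hr t).1 ht
      rw [List.idxOf_append_of_notMem (by rw [hmem]; omega)]
      congr 1
      have : (List.range' (s + 1) m)[t - (s + 1)]'(by simp; omega) = t := by
        rw [List.getElem_range']; omega
      conv_lhs => rw [← this]
      exact (List.nodup_range' : (List.range' (s + 1) m).Nodup).idxOf_getElem _ _
    have i3 : ∀ t ∈ v, v.idxOf t < v.length := fun t ht => List.idxOf_lt_length_iff.2 ht
    refine ⟨fun t => if t ≤ s + m then 0 else ℓ t + 1, ⟨fun t ht hmin => ?_,
      fun a ha b hb hab hc => ?_⟩, ?_⟩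
    · have := hmin (s + 1) (List.mem_append_right _ ((hr _).2 (by omega)))
      rw [if_pos (by omega)]
    · rcases List.mem_append.1 ha with ha' | ha' <;> rcases List.mem_append.1 hb with hb' | hb'
      · have h1 := (hmem a).1 ha'
        have h2 := (hmem b).1 hb'
        rw [if_neg (by omega), if_neg (by omega), i1 a ha', i1 b hb',
          h.succ a ha' b hb' hab fun r hr => hc r (by simp [hr])]
        omega
      · have h1 := (hmem a).1 ha'
        have h2 := (hr b).1 hb'
        omega
      · have h1 := (hr a).1 ha'
        have h2 := (hmem b).1 hb'
        have h0 : ℓ b = 0 := h.zero b hb' fun u hu => by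
          have h3 := (hmem u).1 hu
          rcases hc u (by simp [hu]) with h' | h' <;> omega
        have := i3 b hb'
        rw [if_neg (by omega), if_pos (by omega), i2 a ha', i1 b hb', if_pos (by omega), h0]
      · have h1 := (hr a).1 ha'
        have h2 := (hr b).1 hb'
        rw [if_pos (by omega), if_pos (by omega), i2 a ha', i2 b hb', if_neg (by omega)]
    · rw [queue_append, shapeQueue]
      congr 1
      · rw [List.eq_replicate_iff]
        refine ⟨by simp [queue], fun c hc => ?_⟩
        simp only [queue, List.mem_reverse, List.mem_map] at hc
        obtain ⟨t, ht, rfl⟩ := hc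
        rw [if_pos ((hr t).1 ht).2]
      · rw [← hq]
        simp only [queue, List.map_reverse, List.map_map]
        congr 1
        refine List.map_congr_left fun t ht => ?_
        have := (hmem t).1 ht
        rw [if_neg (by omega)]
        rfl

theorem labelQueue_ZstarWord (lam : YoungDiagram) :
    (ZstarWord lam).labelQueue = shapeQueue lam.rowLens := by
  obtain ⟨ℓ, h, hq⟩ := exists_labeling_fillRows lam.pos_of_mem_rowLens 0
  rw [(ZstarWord lam).labelQueue_eq h]
  exact hq

/-! ### Catabolizability and its characterization -/

theorem rows_injective {l l' : List ℕ} (hl : ∀ p ∈ l, 0 < p) (hl' : ∀ p ∈ l', 0 < p)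
    (h : rows l = rows l') : l = l' := by
  induction l generalizing l' with
  | nil =>
    cases l' with
    | nil => rfl
    | cons m l' =>
      have h1 := congrFun h 0
      have h2 := hl' m (by simp)
      simp [rows] at h1
      omega
  | cons k l ih =>
    have hk := hl k (by simp)
    cases l' with
    | nil =>
      have h1 := congrFun h 0
      simp [rows] at h1
      omega
    | cons m l' =>
      rw [rows_cons, rows_cons] at h
      have h1 : k = m := congrFun h 0
      rw [h1, ih (fun p hp => hl p (by simp [hp])) (fun p hp => hl' p (by simp [hp]))
        (funext fun i => congrFun h (i + 1))]

theorem ext_rowLens {lam mu : YoungDiagram} (h : lam.rowLens = mu.rowLens) : lam = mu :=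
  YoungDiagram.equivListRowLens.injective (Subtype.ext h)

theorem sum_rowLens (lam : YoungDiagram) : lam.rowLens.sum = lam.card := by
  have h := Finset.card_eq_sum_card_fiberwise (s := lam.cells) (f := Prod.fst)
    (t := Finset.range (lam.colLen 0)) fun c hc => by
      have : (c.1, 0) ∈ lam := lam.up_left_mem le_rfl (Nat.zero_le c.2) hc
      simpa using YoungDiagram.mem_iff_lt_colLen.1 this
  rw [YoungDiagram.card, h]
  exact Finset.sum_congr (s₁ := Finset.range (lam.colLen 0)) rfl fun i _ => lam.rowLen_eq_card

theorem DominatedBy.antisymm {lam mu : YoungDiagram} (h : DominatedBy lam mu)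
    (h' : DominatedBy mu lam) : lam = mu := by
  refine ext_rowLens (rows_injective lam.pos_of_mem_rowLens mu.pos_of_mem_rowLens ?_)
  funext i
  have h1 := fun k => le_antisymm (h.2 k) (h'.2 k)
  simp only [← sum_rows] at h1
  have h2 := h1 (i + 1)
  rw [Finset.sum_range_succ, Finset.sum_range_succ, h1 i] at h2
  omega

/-- `lam` is the result of the insertion algorithm for `w`. The cap exceeds the length of `w`, so
that it is no restriction. -/
def HasInsertionShape (w : StandardWord) (lam : YoungDiagram) : Prop :=
  Eval (capRow (w.1.length + 1)) w.labelQueue (consRow (w.1.length + 1) (rows lam.rowLens))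

theorem exists_hasInsertionShape (w : StandardWord) : ∃ lam, HasInsertionShape w lam := by
  obtain ⟨l, h1, h2, h3, -⟩ := exists_eval_catabolizable w.nodup w.isLabeling
    (by omega : 1 ≤ w.1.length + 1)
  refine ⟨YoungDiagram.ofRowLens l h1.sortedGE, ?_⟩
  rw [HasInsertionShape, YoungDiagram.rowLens_ofRowLens_eq_self fun p hp => (h2 p hp).1]
  exact h3

theorem HasInsertionShape.isCatabolizability {w : StandardWord} {lam : YoungDiagram}
    (h : HasInsertionShape w lam) : IsCatabolizability (insertionTableau w.1) lam := by
  obtain ⟨l, h1, h2, h3, h4⟩ := exists_eval_catabolizable w.nodup w.isLabeling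
    (by omega : 1 ≤ w.1.length + 1)
  have e := h3.unique h
  obtain rfl : l = lam.rowLens := rows_injective (fun p hp => (h2 p hp).1) lam.pos_of_mem_rowLens
    (funext fun i => congrFun e (i + 1))
  refine ⟨h4, fun μ hμ => ⟨?_, fun k => ?_⟩⟩
  · rw [← sum_rowLens, ← sum_rowLens, hμ.sum_eq w.nodup, h4.sum_eq w.nodup]
  · have hsum := hμ.sum_eq w.nodup
    have := catabolizable_dominated w.nodup w.isLabeling μ.rowLens_sorted.pairwise
      (fun p hp => ⟨μ.pos_of_mem_rowLens p hp, (List.le_sum_of_mem hp).trans (by omega)⟩) hμ h k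
    rwa [← sum_rows lam.rowLens]

theorem HasInsertionShape.ctype_eq {w : StandardWord} {lam : YoungDiagram}
    (h : HasInsertionShape w lam) : ctype w = lam := by
  have hex : ∃ lam, IsCatabolizability (insertionTableau w.1) lam := ⟨lam, h.isCatabolizability⟩
  have h1 := hex.choose_spec
  have h2 := h.isCatabolizability
  rw [ctype, dif_pos hex]
  exact (h2.2 _ h1.1).antisymm (h1.2 _ h2.1)

theorem ctype_eq_of_iff {u v : StandardWord}
    (h : ∀ lam, HasInsertionShape u lam → HasInsertionShape v lam) : ctype u = ctype v := by
  obtain ⟨lam, hlam⟩ := exists_hasInsertionShape u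
  rw [hlam.ctype_eq, (h lam hlam).ctype_eq]

theorem ctype_eq_of_queueStep {u v : StandardWord} (h : QueueStep u.labelQueue v.labelQueue) :
    ctype u = ctype v := by
  refine ctype_eq_of_iff fun lam hlam => ?_
  have hlen : v.1.length = u.1.length := by
    rw [← v.length_labelQueue, ← u.length_labelQueue]
    exact (QueueEquiv.length_eq (Relation.ReflTransGen.single h)).symm
  rw [HasInsertionShape, hlen]
  exact (h.eval_iff (capRow_antitone _)).1 hlam

theorem isNormalizedInvariant_ctype : IsNormalizedInvariant ctype where
  corotation := by
    rintro u v ⟨y, a, -, hu, hv, ha⟩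
    refine ctype_eq_of_iff fun lam hlam => ?_
    obtain ⟨q, h1, h2⟩ := labelQueue_of_corotation hu hv ha
    have hlen : v.1.length = u.1.length := by simp [hu, hv]
    rw [HasInsertionShape, h1] at hlam
    rw [HasInsertionShape, hlen, h2]
    rcases hlam.of_cons with ⟨h, -⟩ | ⟨-, h⟩
    · obtain ⟨d, hd⟩ : ∃ d, cochargeLabel u.1 a = d + 1 := ⟨cochargeLabel u.1 a - 1, by omega⟩
      rw [hd] at h
      simp [capRow, consRow] at h
    · exact h
  catabolism := by
    rintro u v ⟨x, y, a, b, hu, hv, hab⟩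
    have hl := u.isLabeling
    have hex := hl.exists_between (p := a) (q := b) (by rw [hu]; simp) (by rw [hu]; simp) hab
    have hfar : cochargeLabel u.1 a + 2 ≤ cochargeLabel u.1 b ∨
        cochargeLabel u.1 b + 2 ≤ cochargeLabel u.1 a := by
      rw [lt_abs] at hab; omega
    refine ctype_eq_of_queueStep ?_
    rw [StandardWord.labelQueue]
    generalize cochargeLabel u.1 = ℓ at *
    rw [hu] at hl hex
    have hl' := hl.swap hex
    rw [← hv] at hl'
    rw [v.labelQueue_eq hl', hu, hv]
    exact queueStep_far hfar
  knuth := by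
    intro u v h
    obtain ⟨h1, h2⟩ := u.isLabeling.knuth u.nodup h
    refine ctype_eq_of_queueStep ?_
    rw [v.labelQueue_eq h1]
    exact h2
  normalized := by
    intro lam
    refine HasInsertionShape.ctype_eq ?_
    rw [HasInsertionShape, labelQueue_ZstarWord]
    refine eval_shapeQueue lam.rowLens_sorted.pairwise fun p hp => ?_
    have h1 := List.le_sum_of_mem hp
    have h2 : ((ZstarWord lam).1).length = lam.rowLens.sum := by
      have := ((List.reverse_perm (Zstar lam)).flatten).length_eq
      rw [Zstar, flatten_fillRows, List.length_range'] at this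
      exact this
    omega

theorem IsNormalizedInvariant.eq_ctype {F : StandardWord → YoungDiagram}
    (hF : IsNormalizedInvariant F) : F = ctype := by
  funext w
  obtain ⟨lam, hlam⟩ := exists_hasInsertionShape w
  rw [hlam.ctype_eq]
  obtain ⟨w', K, h1, h2, h3⟩ := exists_rowsQueue hF hlam w 0 (capRow_antitone _) rfl
    (fun i hi => by obtain ⟨i, rfl⟩ : ∃ k, i = k + 1 := ⟨i - 1, by omega⟩; rfl) rfl
  rw [rowsQueue_rows lam.pos_of_mem_rowLens _ _ h2, ← labelQueue_ZstarWord] at h3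
  rw [← h1, StandardWord.labelQueue_injective h3, hF.normalized]

end Catabolism

theorem mainTheorem2 :
    (∀ w : Catabolism.StandardWord,
      Catabolism.IsCatabolizability (Catabolism.insertionTableau w.1) (Catabolism.ctype w)) ∧
    ∀ F : Catabolism.StandardWord → YoungDiagram,
      Catabolism.IsNormalizedInvariant F ↔ F = Catabolism.ctype := by
  refine ⟨fun w => ?_, fun F => ⟨fun hF => hF.eq_ctype, fun h => ?_⟩⟩
  · obtain ⟨lam, hlam⟩ := Catabolism.exists_hasInsertionShape w
    rw [hlam.ctype_eq]
    exact hlam.isCatabolizability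
  · rw [h]
    exact Catabolism.isNormalizedInvariant_ctype
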